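/- Let $\Sigma$ be a compact smooth surface without boundary (for instance a closed oriented surface), and let $E=\Sigma\times\mathbb{C}$ be the trivial complex line bundle with its standard trivialization $\tau$. Let $\mathcal{A}^k(\Sigma)$ be the smooth complex-valued $k$-forms, let $\mathcal{Z}^1(\Sigma)$ and $\mathcal{B}^1(\Sigma)$ be the closed and the exact $1$-forms, and let $H^1_{dR}(\Sigma)=\mathcal{Z}^1(\Sigma)/\mathcal{B}^1(\Sigma)$. A connection on $E$ is an additive operator $D$ from sections of $E$ to $E$-valued $1$-forms with $D(fs)=f\,D(s)+df\otimes s$ for $f\in\mathcal{A}^0(\Sigma)$; extend it to $E$-valued $1$-forms by $D(\alpha\otimes s)=d\alpha\otimes s-\alpha\wedge D(s)$. It is flat if $D\circ D=0$, and $\mathcal{F}$ denotes the set of flat connections. The gauge group $\mathcal{G}$ of smooth maps $g:\Sigma\to\mathbb{C}^*$ acts on connections by $g\cdot D=g^{-1}\circ D\circ g$; in terms of the connection form $\eta$, given by $D\tau=\eta\otimes\tau$, this is $\eta\mapsto\eta+g^{-1}dg$. The de Rham moduli space $\mathcal{F}/\mathcal{G}$ is the set of classes of flat connections modulo gauge transformations.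 Integration of closed $1$-forms over smooth singular $1$-simplices determines the de Rham isomorphism $H^1_{dR}(\Sigma)\cong H^1(\Sigma,\mathbb{C})$ onto singular cohomology: the class of $\eta$ corresponds to the class $\kappa$ if and only if $\kappa$ is represented by a singular cocycle whose value on every smooth $1$-simplex $\sigma$ is $\int_\sigma\eta$. Let $$i^*:H^1(\Sigma,\mathbb{Z})\longrightarrow H^1(\Sigma,\mathbb{C})\cong H^1_{dR}(\Sigma)$$ be the homomorphism induced by the inclusion $\mathbb{Z}\hookrightarrow\mathbb{C}$ of coefficients. Then $i^*$ is injective, the connection form of every flat connection is closed, and the rule that sends a flat connection with connection form $\eta$ to the class of $\frac{1}{2\pi i}\eta$ induces a bijection $$\mathcal{F}/\mathcal{G}\;\cong\;\operatorname{coker}(i^*)=H^1_{dR}(\Sigma)/i^*H^1(\Sigma,\mathbb{Z}).$$ -/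

import Mathlib

open scoped Manifold ContDiff

noncomputable section

namespace FlatLine

/-! ### Singular cohomology in degree one -/

section Singular

variable (X : Type*) [TopologicalSpace X] (A : Type*) [AddCommGroup A]

/-- Singular `n`-simplices of `X`. -/
abbrev Simplex (n : ℕ) : Type _ := C(stdSimplex ℝ (Fin (n + 1)), X)

variable {X} in
/-- The `i`-th face of a singular `(n + 1)`-simplex (the vertex `i` is omitted). -/
def Simplex.face {n : ℕ} (i : Fin (n + 2)) (σ : Simplex X (n + 1)) : Simplex X n :=
  σ.comp ⟨stdSimplex.map i.succAbove, stdSimplex.continuous_map _⟩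

/-- Singular `n`-cochains of `X` with coefficients in `A`, that is, homomorphisms to `A` from the
free abelian group on the singular `n`-simplices. -/
abbrev Cochain (n : ℕ) : Type _ := Simplex X n → A

/-- The singular coboundary operator. -/
def coboundary (n : ℕ) : Cochain X A n →+ Cochain X A (n + 1) where
  toFun c σ := ∑ i : Fin (n + 2), (-1 : ℤ) ^ (i : ℕ) • c (σ.face i)
  map_zero' := by ext; simp
  map_add' c c' := by ext; simp [Finset.sum_add_distrib]

/-- Singular `1`-cocycles. -/
abbrev Cocycle1 : AddSubgroup (Cochain X A 1) := (coboundary X A 1).ker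

/-- The first singular cohomology group `H¹(X, A)`: cocycles modulo coboundaries. -/
abbrev H1 : Type _ := Cocycle1 X A ⧸ (coboundary X A 0).range.addSubgroupOf (Cocycle1 X A)

variable {A} {B : Type*} [AddCommGroup B]

/-- Change of coefficients on `1`-cocycles. -/
def cocycleMap (f : A →+ B) : Cocycle1 X A →+ Cocycle1 X B where
  toFun c := ⟨fun σ => f (c.1 σ), by
    have h := c.2
    rw [AddMonoidHom.mem_ker] at h ⊢
    ext σ
    have := congrArg f (congrFun h σ)
    simpa [coboundary, map_sum] using this⟩
  map_zero' := by ext; simp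
  map_add' c c' := by ext; simp

/-- The homomorphism `H¹(X, A) → H¹(X, B)` induced by a homomorphism of coefficient groups. -/
def coeffMap (f : A →+ B) : H1 X A →+ H1 X B :=
  QuotientAddGroup.map _ _ (cocycleMap X f) <| by
    rintro c ⟨b, hb⟩
    refine ⟨fun τ => f (b τ), ?_⟩
    ext σ
    have := congrArg f (congrFun hb σ)
    simpa [coboundary, cocycleMap, map_sum] using this

end Singular

/-! ### Complex differential forms of degree at most two on a smooth surface -/

section Forms

variable (M : Type*) [TopologicalSpace M] [ChartedSpace (EuclideanSpace ℝ (Fin 2)) M]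

instance : ContMDiffRing 𝓘(ℝ, ℂ) ∞ ℂ where
  contMDiff_add := contMDiff_add 𝓘(ℝ, ℂ) ∞
  contMDiff_mul := by
    rw [← modelWithCornersSelf_prod, chartedSpaceSelf_prod, contMDiff_iff_contDiff]
    exact contDiff_mul

/-- Smooth complex-valued functions. -/
abbrev A0 : Type _ := C^∞⟮𝓡 2, M; 𝓘(ℝ, ℂ), ℂ⟯

/-- Complex-valued (not necessarily smooth) fields of covectors. -/
abbrev CovectorField : Type _ := ∀ x : M, TangentSpace (𝓡 2) x →L[ℝ] ℂ

variable {M}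

/-- The expression of a field of covectors in the chart around `x`: its pullback under the inverse
of the chart. -/
def CovectorField.inChart (η : CovectorField M) (x : M) (y : EuclideanSpace ℝ (Fin 2)) :
    EuclideanSpace ℝ (Fin 2) →L[ℝ] ℂ :=
  (η ((extChartAt (𝓡 2) x).symm y)).comp
    (mfderiv 𝓘(ℝ, EuclideanSpace ℝ (Fin 2)) (𝓡 2) (extChartAt (𝓡 2) x).symm y)

lemma inChart_add (η θ : CovectorField M) (x : M) :
    (η + θ).inChart x = η.inChart x + θ.inChart x := by
  ext y v; rfl

lemma inChart_mul (f : M → ℂ) (η : CovectorField M) (x : M) :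
    CovectorField.inChart (fun z => f z • η z) x
      = fun y => f ((extChartAt (𝓡 2) x).symm y) • η.inChart x y := by
  ext y v; rfl

lemma inChart_smul (c : ℂ) (η : CovectorField M) (x : M) :
    (c • η).inChart x = fun y => c • η.inChart x y :=
  inChart_mul (fun _ => c) η x

variable (M) in
/-- The fields of covectors that are smooth in charts. -/
def smoothCovectorFields : Submodule ℂ (CovectorField M) where
  carrier := {η | ∀ x : M, ContDiffOn ℝ ∞ (η.inChart x) (extChartAt (𝓡 2) x).target}
  zero_mem' x := by
    have : (0 : CovectorField M).inChart x = fun _ => 0 := by ext y v; rfl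
    rw [this]
    exact contDiffOn_const
  add_mem' hη hθ x := by
    rw [inChart_add]
    exact (hη x).add (hθ x)
  smul_mem' c η hη x := by
    rw [inChart_smul]
    exact (hη x).const_smul c

variable (M) in
/-- Smooth complex-valued `1`-forms. -/
def A1 : Type _ := smoothCovectorFields M

instance : AddCommGroup (A1 M) := (smoothCovectorFields M).addCommGroup

instance : Module ℂ (A1 M) := (smoothCovectorFields M).module

/-- The underlying field of covectors of a smooth `1`-form. -/
def A1.field (η : A1 M) : CovectorField M := Subtype.val (p := (· ∈ smoothCovectorFields M)) η

lemma A1.smooth (η : A1 M) (x : M) :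
    ContDiffOn ℝ ∞ (η.field.inChart x) (extChartAt (𝓡 2) x).target :=
  Subtype.property (p := (· ∈ smoothCovectorFields M)) η x

/-- A smooth `1`-form from a field of covectors that is smooth in charts. -/
def A1.mk (η : CovectorField M)
    (h : ∀ x : M, ContDiffOn ℝ ∞ (η.inChart x) (extChartAt (𝓡 2) x).target) : A1 M :=
  (⟨η, h⟩ : smoothCovectorFields M)

lemma A1.ext {η θ : A1 M} (h : ∀ x v, η.field x v = θ.field x v) : η = θ :=
  Subtype.ext (funext fun x => ContinuousLinearMap.ext (h x))

lemma A1.field_add (η θ : A1 M) : (η + θ).field = η.field + θ.field := rfl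

lemma A1.field_smul (c : ℂ) (η : A1 M) : (c • η).field = c • η.field := rfl

/-- The product of a smooth function and a smooth `1`-form. -/
instance [IsManifold (𝓡 2) ∞ M] : SMul (A0 M) (A1 M) where
  smul f η := A1.mk (fun x => f x • η.field x) fun x => by
    rw [inChart_mul]
    have h := (f.contMDiff.contMDiffOn (s := Set.univ)).comp (contMDiffOn_extChartAt_symm x)
      (fun _ _ => Set.mem_univ _)
    exact (contMDiffOn_iff_contDiffOn.1 h).smul (η.smooth x)

variable [IsManifold (𝓡 2) ∞ M]

lemma one_smul_form (η : A1 M) : (1 : A0 M) • η = η :=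
  A1.ext fun _ _ => one_mul _

lemma mul_smul_form (f g : A0 M) (η : A1 M) : (f * g) • η = f • g • η :=
  A1.ext fun _ _ => mul_assoc _ _ _

lemma smul_add_form (f : A0 M) (η θ : A1 M) : f • (η + θ) = f • η + f • θ :=
  A1.ext fun _ _ => mul_add _ _ _

lemma smul_zero_form (f : A0 M) : f • (0 : A1 M) = 0 :=
  A1.ext fun _ _ => mul_zero _

lemma inChart_mfderiv (f : A0 M) (x : M) :
    Set.EqOn (CovectorField.inChart (M := M) (fun z => mfderiv (𝓡 2) 𝓘(ℝ, ℂ) f z) x)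
      (fderiv ℝ (f ∘ (extChartAt (𝓡 2) x).symm)) (extChartAt (𝓡 2) x).target := by
  intro y hy
  have h1 : MDifferentiableAt (𝓡 2) 𝓘(ℝ, ℂ) f ((extChartAt (𝓡 2) x).symm y) :=
    f.contMDiff.mdifferentiableAt (by simp)
  have h2 : MDifferentiableAt 𝓘(ℝ, EuclideanSpace ℝ (Fin 2)) (𝓡 2) (extChartAt (𝓡 2) x).symm y :=
    ((contMDiffOn_extChartAt_symm (n := ∞) x).contMDiffAt
      ((isOpen_extChartAt_target x).mem_nhds hy)).mdifferentiableAt (by simp)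
  have h3 := mfderiv_comp y h1 h2
  rw [mfderiv_eq_fderiv] at h3
  exact h3.symm

/-- The differential of a smooth function. -/
def d0 : A0 M →+ A1 M where
  toFun f := A1.mk (fun x => mfderiv (𝓡 2) 𝓘(ℝ, ℂ) f x) fun x => by
    refine ContDiffOn.congr ?_ (inChart_mfderiv f x)
    have h := (f.contMDiff.contMDiffOn (s := Set.univ)).comp (contMDiffOn_extChartAt_symm x)
      (fun _ _ => Set.mem_univ _)
    exact (contMDiffOn_iff_contDiffOn.1 h).fderiv_of_isOpen (isOpen_extChartAt_target x) le_rfl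
  map_zero' := by
    refine A1.ext fun x v => ?_
    have : mfderiv (𝓡 2) 𝓘(ℝ, ℂ) (fun _ : M => (0 : ℂ)) x = 0 := mfderiv_const
    exact DFunLike.congr_fun this v
  map_add' f g := by
    refine A1.ext fun x v => ?_
    have hf : MDifferentiableAt (𝓡 2) 𝓘(ℝ, ℂ) f x := f.contMDiff.mdifferentiableAt (by simp)
    have hg : MDifferentiableAt (𝓡 2) 𝓘(ℝ, ℂ) g x := g.contMDiff.mdifferentiableAt (by simp)
    exact DFunLike.congr_fun (mfderiv_add hf hg) v

lemma d0_mul (f g : A0 M) : d0 (f * g) = f • d0 g + g • d0 f := by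
  refine A1.ext fun x v => ?_
  have hf : MDifferentiableAt (𝓡 2) 𝓘(ℝ, ℂ) f x := f.contMDiff.mdifferentiableAt (by simp)
  have hg : MDifferentiableAt (𝓡 2) 𝓘(ℝ, ℂ) g x := g.contMDiff.mdifferentiableAt (by simp)
  exact DFunLike.congr_fun (hf.hasMFDerivAt.mul hg.hasMFDerivAt).mfderiv v

/-- A constant function. -/
def A0.const (c : ℂ) : A0 M := ⟨fun _ => c, contMDiff_const⟩

lemma d0_const (c : ℂ) : d0 (A0.const c : A0 M) = 0 := by
  refine A1.ext fun x v => ?_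
  have : mfderiv (𝓡 2) 𝓘(ℝ, ℂ) (fun _ : M => c) x = 0 := mfderiv_const
  exact DFunLike.congr_fun this v

lemma d0_const_mul (c : ℂ) (f : A0 M) : d0 (A0.const c * f) = c • d0 f := by
  rw [d0_mul, d0_const, smul_zero_form, add_zero]
  rfl

/-- The exterior derivative of a `1`-form on the plane. -/
def planeDeriv (w : EuclideanSpace ℝ (Fin 2) → EuclideanSpace ℝ (Fin 2) →L[ℝ] ℂ) :
    EuclideanSpace ℝ (Fin 2) → EuclideanSpace ℝ (Fin 2) [⋀^Fin 2]→L[ℝ] ℂ :=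
  extDeriv fun y => ContinuousAlternatingMap.ofSubsingleton ℝ (EuclideanSpace ℝ (Fin 2)) ℂ
    (0 : Fin 1) (w y)

/-- The differential at `x` of the chart around `x`. -/
def chartDeriv (x : M) : TangentSpace (𝓡 2) x →L[ℝ] EuclideanSpace ℝ (Fin 2) :=
  mfderiv (𝓡 2) 𝓘(ℝ, EuclideanSpace ℝ (Fin 2)) (extChartAt (𝓡 2) x) x

/-- The exterior derivative of a `1`-form, computed at each point in the chart around it. -/
def d1 (η : A1 M) (x : M) : TangentSpace (𝓡 2) x [⋀^Fin 2]→L[ℝ] ℂ :=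
  (planeDeriv (η.field.inChart x) (extChartAt (𝓡 2) x x)).compContinuousLinearMap (chartDeriv x)

/-- The wedge product of two covectors, `(α ∧ β)(v, w) = α(v) β(w) - α(w) β(v)`. -/
def wedge {V : Type*} [AddCommGroup V] [Module ℝ V] [TopologicalSpace V] (α β : V →L[ℝ] ℂ) :
    V [⋀^Fin 2]→L[ℝ] ℂ where
  toFun v := α (v 0) * β (v 1) - α (v 1) * β (v 0)
  map_update_add' m i x y := by
    fin_cases i <;> simp [Function.update] <;> ring
  map_update_smul' m i c x := by
    fin_cases i <;> simp [Function.update] <;> ring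
  map_eq_zero_of_eq' v i j h hij := by
    fin_cases i <;> fin_cases j <;> simp_all
  cont := by fun_prop

lemma differentiableAt_inChart (η : A1 M) (x : M) :
    DifferentiableAt ℝ (η.field.inChart x) (extChartAt (𝓡 2) x x) :=
  ((η.smooth x).contDiffAt ((isOpen_extChartAt_target x).mem_nhds
    (mem_extChartAt_target x))).differentiableAt (by simp)

lemma planeDeriv_apply {w : EuclideanSpace ℝ (Fin 2) → EuclideanSpace ℝ (Fin 2) →L[ℝ] ℂ}
    {y : EuclideanSpace ℝ (Fin 2)} (h : DifferentiableAt ℝ w y)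
    (v : Fin 2 → EuclideanSpace ℝ (Fin 2)) :
    planeDeriv w y v = fderiv ℝ w y (v 0) (v 1) - fderiv ℝ w y (v 1) (v 0) := by
  let L := (ContinuousAlternatingMap.ofSubsingletonLIE (𝕜 := ℝ) (E := EuclideanSpace ℝ (Fin 2))
    (F := ℂ) (0 : Fin 1)).toContinuousLinearEquiv
  have h1 : HasFDerivAt (fun y => ContinuousAlternatingMap.ofSubsingleton ℝ
      (EuclideanSpace ℝ (Fin 2)) ℂ (0 : Fin 1) (w y)) (L.toContinuousLinearMap ∘L fderiv ℝ w y) y :=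
    L.toContinuousLinearMap.hasFDerivAt.comp y h.hasFDerivAt
  unfold planeDeriv extDeriv
  rw [h1.fderiv]
  simp [ContinuousAlternatingMap.alternatizeUncurryFin_apply, Fin.sum_univ_two, L,
    Fin.removeNth, sub_eq_add_neg]

lemma d1_apply (η : A1 M) (x : M) (v : Fin 2 → TangentSpace (𝓡 2) x) :
    d1 η x v = planeDeriv (η.field.inChart x) (extChartAt (𝓡 2) x x)
      (fun i => chartDeriv x (v i)) := rfl

lemma d1_add (η θ : A1 M) (x : M) : d1 (η + θ) x = d1 η x + d1 θ x := by
  ext v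
  have h1 := differentiableAt_inChart η x
  have h2 := differentiableAt_inChart θ x
  rw [ContinuousAlternatingMap.add_apply, d1_apply, d1_apply, d1_apply, A1.field_add,
    inChart_add, planeDeriv_apply h1, planeDeriv_apply h2, planeDeriv_apply (h1.add h2),
    fderiv_add h1 h2]
  simp only [add_apply]
  ring

lemma d1_smul (c : ℂ) (η : A1 M) (x : M) : d1 (c • η) x = c • d1 η x := by
  ext v
  have h1 := differentiableAt_inChart η x
  rw [ContinuousAlternatingMap.smul_apply, d1_apply, d1_apply, A1.field_smul,
    inChart_smul, planeDeriv_apply h1, show (fun y => c • η.field.inChart x y)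
      = c • η.field.inChart x from rfl, planeDeriv_apply (h1.const_smul c),
    fderiv_const_smul h1]
  simp only [smul_apply, smul_eq_mul]
  ring

variable (M) in
/-- Closed complex-valued `1`-forms. -/
def Z1 : Submodule ℂ (A1 M) where
  carrier := {η | ∀ x, d1 η x = 0}
  zero_mem' x := by
    ext v
    have h := congrArg (fun T => T v) (d1_smul 0 (0 : A1 M) x)
    rw [zero_smul] at h
    exact h.trans (zero_mul _)
  add_mem' hη hθ x := by rw [d1_add, hη x, hθ x, add_zero]
  smul_mem' c η hη x := by
    ext v
    rw [d1_smul, hη x]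
    exact mul_zero c

variable (M) in
/-- Exact complex-valued `1`-forms. -/
def B1 : Submodule ℂ (A1 M) where
  carrier := {η | ∃ f : A0 M, d0 f = η}
  zero_mem' := ⟨0, map_zero _⟩
  add_mem' := by
    rintro _ _ ⟨f, rfl⟩ ⟨g, rfl⟩
    exact ⟨f + g, map_add _ _ _⟩
  smul_mem' := by
    rintro c _ ⟨f, rfl⟩
    exact ⟨_, d0_const_mul c f⟩

variable (M) in
/-- The first complex de Rham cohomology `H¹(M) = Z¹(M) / B¹(M)`. -/
abbrev H1dR : Type _ := Z1 M ⧸ (B1 M).comap (Z1 M).subtype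

end Forms

/-! ### Integration of `1`-forms and the comparison of cohomology classes -/

section Periods

variable {M : Type*} [TopologicalSpace M] [ChartedSpace (EuclideanSpace ℝ (Fin 2)) M]

/-- A singular `1`-simplex as a path on `[0, 1]`, from its vertex `0` to its vertex `1` (extended
by constants to the real line). -/
def Simplex.path (σ : Simplex M 1) (t : ℝ) : M :=
  σ (stdSimplexHomeomorphUnitInterval.symm (Set.projIcc 0 1 zero_le_one t))

/-- A singular `1`-simplex is smooth if it is a smooth path. -/
def Simplex.IsSmooth (σ : Simplex M 1) : Prop :=
  ContMDiffOn 𝓘(ℝ, ℝ) (𝓡 2) ∞ σ.path (Set.Icc 0 1)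

/-- The integral of a `1`-form along a (smooth) singular `1`-simplex. -/
def integral (η : A1 M) (σ : Simplex M 1) : ℂ :=
  ∫ t in (0 : ℝ)..1, η.field (σ.path t)
    (mfderivWithin 𝓘(ℝ, ℝ) (𝓡 2) σ.path (Set.Icc 0 1) t (1 : ℝ))

/-- A closed `1`-form `η` represents the singular class `κ` if `κ` is the class of a singular
cocycle whose value on every smooth `1`-simplex is the integral of `η`. -/
def Represents [IsManifold (𝓡 2) ∞ M] (η : Z1 M) (κ : H1 M ℂ) : Prop :=
  ∃ c : Cocycle1 M ℂ, (QuotientAddGroup.mk c : H1 M ℂ) = κ ∧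
    ∀ σ : Simplex M 1, σ.IsSmooth → c.1 σ = integral η.1 σ

end Periods

/-! ### Connections on the trivial line bundle and gauge transformations -/

section Connections

variable (M : Type*) [TopologicalSpace M] [ChartedSpace (EuclideanSpace ℝ (Fin 2)) M]
  [IsManifold (𝓡 2) ∞ M]

/-- A connection on the trivial complex line bundle with its fixed trivialization, so that
`E`-valued forms are complex-valued forms. (By the Leibniz rule it is complex linear.) -/
@[ext]
structure Connection where
  /-- The covariant differential of a section. -/
  toHom : A0 M →+ A1 M
  leibniz (f s : A0 M) : toHom (f * s) = f • toHom s + s • d0 f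

/-- The gauge group of smooth maps to the nonzero complex numbers. -/
abbrev Gauge : Type _ := C^∞⟮𝓡 2, M; 𝓘(ℝ, ℂ), ℂˣ⟯

variable {M}

/-- A gauge transformation as a complex-valued function. -/
def Gauge.toA0 (g : Gauge M) : A0 M :=
  ⟨fun x => (g x : ℂ), Units.contMDiff_val.comp g.contMDiff⟩

lemma Gauge.toA0_one : Gauge.toA0 (1 : Gauge M) = 1 := rfl

lemma Gauge.toA0_mul (g h : Gauge M) : (g * h).toA0 = g.toA0 * h.toA0 := rfl

lemma Gauge.toA0_inv_mul (g : Gauge M) : (g⁻¹).toA0 * g.toA0 = 1 := by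
  rw [← Gauge.toA0_mul, inv_mul_cancel, Gauge.toA0_one]

/-- The extension of the covariant differential to `E`-valued `1`-forms,
`D (α τ) = dα τ - α ∧ D τ`, where `τ = 1` is the trivialization. -/
def Connection.extend (D : Connection M) (α : A1 M) (x : M) :
    TangentSpace (𝓡 2) x [⋀^Fin 2]→L[ℝ] ℂ :=
  d1 α x - wedge (α.field x) ((D.toHom 1).field x)

/-- A connection is flat if its curvature, given by `s ↦ D (D s)`, vanishes. -/
def Connection.IsFlat (D : Connection M) : Prop :=
  ∀ (s : A0 M) (x : M), D.extend (D.toHom s) x = 0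

/-- The action of gauge transformations on connections, `(g • D) s = g⁻¹ D (g s)`. In terms of
the connection form it is `η ↦ η + g⁻¹ dg`. -/
instance gaugeAction : MulAction (Gauge M) (Connection M) where
  smul g D :=
    { toHom :=
        { toFun := fun s => Gauge.toA0 g⁻¹ • D.toHom (g.toA0 * s)
          map_zero' := by rw [mul_zero, map_zero, smul_zero_form]
          map_add' := fun s t => by rw [mul_add, map_add, smul_add_form] }
      leibniz := fun f s => by
        change Gauge.toA0 g⁻¹ • D.toHom (g.toA0 * (f * s))
          = f • Gauge.toA0 g⁻¹ • D.toHom (g.toA0 * s) + s • d0 f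
        rw [mul_left_comm, D.leibniz, smul_add_form, ← mul_smul_form, ← mul_smul_form,
          ← mul_smul_form, mul_comm f, ← mul_assoc, Gauge.toA0_inv_mul, one_mul] }
  one_smul D := by
    refine Connection.ext (AddMonoidHom.ext fun s => ?_)
    change Gauge.toA0 (1⁻¹ : Gauge M) • D.toHom (Gauge.toA0 (1 : Gauge M) * s) = D.toHom s
    rw [inv_one, Gauge.toA0_one, one_mul, one_smul_form]
  mul_smul g h D := by
    refine Connection.ext (AddMonoidHom.ext fun s => ?_)
    change Gauge.toA0 (g * h)⁻¹ • D.toHom ((g * h).toA0 * s)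
      = Gauge.toA0 g⁻¹ • Gauge.toA0 h⁻¹ • D.toHom (h.toA0 * (g.toA0 * s))
    rw [mul_inv, Gauge.toA0_mul, Gauge.toA0_mul, mul_smul_form, mul_left_comm, mul_assoc]

variable (M) in
/-- Flat connections. -/
abbrev FlatConnection : Type _ := {D : Connection M // D.IsFlat}

variable (M) in
/-- The de Rham moduli space: flat connections modulo gauge transformations. -/
abbrev Moduli : Type _ :=
  Quotient ((MulAction.orbitRel (Gauge M) (Connection M)).comap
    (Subtype.val : FlatConnection M → Connection M))

end Connections

end FlatLine
end

/-! Write `η = D 1`. The Leibniz rule gives `D s = s η + ds`, so `D` is determined by `η`, and the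
curvature sends `s` to `s dη`; hence flat means closed (`Connection.isFlat_iff`). A gauge
transformation adds `g⁻¹ dg` to `η`. The theorem thus reduces to the claim that the forms `g⁻¹ dg`
are exactly the forms `2πi θ` with `θ` closed of integral class. If `2πi θ = g⁻¹ dg` and `F` is a
local primitive of `θ`, then `g exp(-2πi F)` is locally constant, so the periods of `θ` differ from
the coboundary of `log g / 2πi` by an integer cocycle (`exists_int_class_of_gauge`). Conversely, if
the periods of `θ` are an integer cocycle plus the coboundary of a function `b`, then `exp(2πi b)`
is locally a constant times `exp(2πi F)`, hence smooth, and it is the required `g`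
(`exists_gauge_of_int_class`). Here `b` and the branch of the logarithm may be discontinuous, since
singular 0-cochains are arbitrary functions.

The de Rham isomorphism rests on the local nature of 1-cocycles. A cocycle that vanishes on small
simplices is zero (`cocycle_eq_zero_of_small`), and local functions that differ by constants define
a cocycle (`IsGermSystem.exists_cocycle`). By the Poincaré lemma a closed form has such local
primitives, and their cocycle is integration on smooth simplices (`IsPeriod.eq_integral`). The
periods are the coboundary of `b` only if the form is `db` (`IsPeriod.exists_d0_eq`). A partition of
unity gives surjectivity (`exists_isPeriod_cohomologous`). Injectivity of the integral classes
follows by taking the integer part of the real part of a complex primitive. -/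

noncomputable section

namespace FlatLine

/-! ### Cocycles on affine simplices -/

section Affine

variable {X : Type*} [TopologicalSpace X] {A : Type*} [AddCommGroup A]
variable {E : Type*} [NormedAddCommGroup E] [NormedSpace ℝ E] {K : Set E}

/-- The `i`-th vertex of a singular simplex. -/
def Simplex.vertex {n : ℕ} (σ : Simplex X n) (i : Fin (n + 1)) : X := σ (stdSimplex.vertex i)

lemma Simplex.vertex_face {n : ℕ} (σ : Simplex X (n + 1)) (i : Fin (n + 2)) (j : Fin (n + 1)) :
    (σ.face i).vertex j = σ.vertex (i.succAbove j) := by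
  simp [Simplex.vertex, Simplex.face]

lemma Simplex.vertex_comp {Y : Type*} [TopologicalSpace Y] {n : ℕ} (f : C(X, Y))
    (σ : Simplex X n) (i : Fin (n + 1)) : Simplex.vertex (f.comp σ) i = f (σ.vertex i) := rfl

lemma Simplex.eq_const (τ : Simplex X 0) : τ = ContinuousMap.const _ (τ.vertex 0) := by
  ext t
  have : t = stdSimplex.vertex 0 := by
    ext i
    rw [Fin.fin_one_eq_zero i]
    simp
  rw [this]; rfl

lemma cocycle_faces (c : Cocycle1 X A) (σ : Simplex X 2) :
    c.1 (σ.face 2) + c.1 (σ.face 0) = c.1 (σ.face 1) := by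
  have h := congrFun ((AddMonoidHom.mem_ker).1 c.2) σ
  simp [coboundary, Fin.sum_univ_three] at h
  rw [← sub_eq_zero, ← h]
  abel

/-- A cochain with the cocycle identity. -/
def Cocycle1.mk (c : Simplex X 1 → A)
    (h : ∀ σ : Simplex X 2, c (σ.face 2) + c (σ.face 0) = c (σ.face 1)) : Cocycle1 X A :=
  ⟨c, by
    rw [AddMonoidHom.mem_ker]
    ext σ
    have := h σ
    simp [coboundary, Fin.sum_univ_three]
    rw [← this]
    abel⟩

/-- The coboundary of a function, as a singular `1`-cocycle. -/
def diff : (X → A) →+ Cocycle1 X A where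
  toFun b := Cocycle1.mk (fun σ => b (σ.vertex 1) - b (σ.vertex 0)) fun σ => by
    simp only [Simplex.vertex_face]
    change b (σ.vertex 1) - b (σ.vertex 0) + (b (σ.vertex 2) - b (σ.vertex 1))
      = b (σ.vertex 2) - b (σ.vertex 0)
    abel
  map_zero' := Subtype.ext (funext fun _ => sub_self _)
  map_add' b b' := Subtype.ext (funext fun _ => add_sub_add_comm _ _ _ _)

lemma diff_apply (b : X → A) (σ : Simplex X 1) :
    (diff b).1 σ = b (σ.vertex 1) - b (σ.vertex 0) := rfl

/-- A singular 0-simplex is a point, so a 0-cochain is a function on points with no continuity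
condition. -/
lemma mk_eq_zero_iff (c : Cocycle1 X A) :
    (QuotientAddGroup.mk c : H1 X A) = 0 ↔ ∃ b : X → A, c = diff b := by
  rw [QuotientAddGroup.eq_zero_iff]
  constructor
  · rintro ⟨b, hb⟩
    refine ⟨fun x => b (ContinuousMap.const _ x), Subtype.ext (funext fun σ => ?_)⟩
    have := congrFun hb σ
    rw [diff_apply]
    refine this.symm.trans ?_
    simp [coboundary, Fin.sum_univ_two]
    rw [Simplex.eq_const (σ.face 0), Simplex.eq_const (σ.face 1), Simplex.vertex_face,
      Simplex.vertex_face, ← sub_eq_add_neg]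
    rfl
  · rintro ⟨b, rfl⟩
    refine ⟨fun τ => b (τ.vertex 0), funext fun σ => ?_⟩
    simp [coboundary, Fin.sum_univ_two]
    rw [Simplex.vertex_face, Simplex.vertex_face, diff_apply, ← sub_eq_add_neg]
    rfl

/-- The affine simplex with given vertices in a convex set. -/
def affineSimplex (hK : Convex ℝ K) {n : ℕ} (v : Fin (n + 1) → K) : Simplex K n where
  toFun t := ⟨∑ i, t i • (v i : E),
    hK.sum_mem (fun i _ => t.2.1 i) t.2.2 fun i _ => (v i).2⟩
  continuous_toFun := by
    refine Continuous.subtype_mk (continuous_finsetSum _ fun i _ => ?_) _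
    exact ((continuous_apply i).comp continuous_subtype_val).smul continuous_const

lemma affineSimplex_face (hK : Convex ℝ K) {n : ℕ} (v : Fin (n + 2) → K) (i : Fin (n + 2)) :
    (affineSimplex hK v).face i = affineSimplex hK (v ∘ i.succAbove) := by
  ext t
  change ∑ j, (stdSimplex.map i.succAbove t) j • (v j : E) = ∑ j, t j • (v (i.succAbove j) : E)
  have h : ∀ j, (stdSimplex.map i.succAbove t) j
      = ∑ k with i.succAbove k = j, t k := fun j => by
    rw [stdSimplex.map_coe, FunOnFinite.linearMap_apply_apply]
  simp_rw [h, Finset.sum_smul]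
  rw [← Finset.sum_fiberwise Finset.univ i.succAbove]
  refine Finset.sum_congr rfl fun j _ => Finset.sum_congr rfl fun k hk => ?_
  rw [(Finset.mem_filter.1 hk).2]

lemma affineSimplex_vertex (hK : Convex ℝ K) {n : ℕ} (v : Fin (n + 1) → K) (i : Fin (n + 1)) :
    (affineSimplex hK v).vertex i = v i := by
  ext
  change ∑ j, (stdSimplex.vertex i : stdSimplex ℝ (Fin (n + 1))) j • (v j : E) = v i
  have h : ∀ j, (stdSimplex.vertex i : stdSimplex ℝ (Fin (n + 1))) j = if i = j then 1 else 0 :=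
    fun j => by
      rw [stdSimplex.vertex_coe, Pi.single_apply]
      simp [eq_comm]
  simp [h]

/-- The segment between two points of a convex set. -/
def segmentSimplex (hK : Convex ℝ K) (p q : K) : Simplex K 1 := affineSimplex hK ![p, q]

lemma segmentSimplex_apply (hK : Convex ℝ K) (p q : K) (t : stdSimplex ℝ (Fin 2)) :
    (segmentSimplex hK p q t : E) = t 0 • (p : E) + t 1 • (q : E) := by
  change ∑ i, t i • ((![p, q] i : K) : E) = _
  simp [Fin.sum_univ_two]

lemma segmentSimplex_mem_segment (hK : Convex ℝ K) (p q : K) (t : stdSimplex ℝ (Fin 2)) :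
    (segmentSimplex hK p q t : E) ∈ segment ℝ (p : E) q := by
  rw [segmentSimplex_apply]
  exact ⟨t 0, t 1, t.2.1 0, t.2.1 1, by have := t.2.2; rwa [Fin.sum_univ_two] at this, rfl⟩

lemma segmentSimplex_vertex_zero (hK : Convex ℝ K) (p q : K) :
    (segmentSimplex hK p q).vertex 0 = p := affineSimplex_vertex hK _ 0

lemma segmentSimplex_vertex_one (hK : Convex ℝ K) (p q : K) :
    (segmentSimplex hK p q).vertex 1 = q := affineSimplex_vertex hK _ 1

/-- This is the cocycle identity on the affine triangle with vertices `p`, `q`, `r`. -/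
lemma cocycle_segment_add (c : Cocycle1 X A) (hK : Convex ℝ K) (f : C(K, X)) (p q r : K) :
    c.1 (f.comp (segmentSimplex hK p q)) + c.1 (f.comp (segmentSimplex hK q r))
      = c.1 (f.comp (segmentSimplex hK p r)) := by
  have h := cocycle_faces c (f.comp (affineSimplex hK ![p, q, r]))
  have hf : ∀ i, Simplex.face i (f.comp (affineSimplex hK ![p, q, r]))
      = f.comp (affineSimplex hK (![p, q, r] ∘ i.succAbove)) := fun i => by
    rw [← affineSimplex_face]; rfl
  rw [hf, hf, hf] at h
  have e2 : ![p, q, r] ∘ Fin.succAbove 2 = ![p, q] := by ext i; fin_cases i <;> rfl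
  have e0 : ![p, q, r] ∘ Fin.succAbove 0 = ![q, r] := by ext i; fin_cases i <;> rfl
  have e1 : ![p, q, r] ∘ Fin.succAbove 1 = ![p, r] := by ext i; fin_cases i <;> rfl
  rwa [e2, e0, e1] at h

lemma cocycle_segment_self (c : Cocycle1 X A) (hK : Convex ℝ K) (f : C(K, X)) (p : K) :
    c.1 (f.comp (segmentSimplex hK p p)) = 0 := by
  have := cocycle_segment_add c hK f p p p
  simpa using this

lemma cocycle_segment_sub (c : Cocycle1 X A) (hK : Convex ℝ K) (f : C(K, X)) (p q r : K) :
    c.1 (f.comp (segmentSimplex hK p r)) - c.1 (f.comp (segmentSimplex hK p q))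
      = c.1 (f.comp (segmentSimplex hK q r)) := by
  rw [← cocycle_segment_add c hK f p q r, add_sub_cancel_left]

lemma comp_segmentSimplex_vertex (σ : Simplex X 1) :
    σ.comp (segmentSimplex (convex_stdSimplex ℝ (Fin 2)) (stdSimplex.vertex 0)
      (stdSimplex.vertex 1)) = σ := by
  ext t
  rw [ContinuousMap.comp_apply]
  congr 1
  refine Subtype.ext ((segmentSimplex_apply _ _ _ _).trans (funext fun i => ?_))
  fin_cases i <;> simp <;> rfl

/-- In a convex set, a cocycle is computed on every path from segments. -/
lemma cocycle_comp_eq (c : Cocycle1 X A) (hK : Convex ℝ K) (f : C(K, X)) (p : K)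
    (τ : Simplex K 1) :
    c.1 (f.comp τ) = c.1 (f.comp (segmentSimplex hK p (τ.vertex 1)))
      - c.1 (f.comp (segmentSimplex hK p (τ.vertex 0))) := by
  -- The path is contracted to `p` by `H(s, t) = (1 - s) p + s τ(t)`. Since `Q` is convex, affine
  -- triangles in `Q` are available.
  let Q : Set (ℝ × (Fin 2 → ℝ)) := Set.Icc (0 : ℝ) 1 ×ˢ stdSimplex ℝ (Fin 2)
  have hQ : Convex ℝ Q := (convex_Icc 0 1).prod (convex_stdSimplex ℝ (Fin 2))
  let H : C(Q, K) := ⟨fun z => ⟨(1 - z.1.1) • (p : E) + z.1.1 • (τ ⟨z.1.2, z.2.2⟩ : E),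
      hK p.2 (τ ⟨z.1.2, z.2.2⟩).2 (sub_nonneg.2 z.2.1.2) z.2.1.1 (by ring)⟩, by
    refine Continuous.subtype_mk (Continuous.add ?_ ?_) _
    · fun_prop
    · refine Continuous.smul (by fun_prop) (continuous_subtype_val.comp (τ.continuous.comp ?_))
      fun_prop⟩
  let w : ∀ (s : ℝ) (_ : s ∈ Set.Icc (0 : ℝ) 1) (t : stdSimplex ℝ (Fin 2)), Q :=
    fun s hs t => ⟨(s, t), hs, t.2⟩
  have h0 : (0 : ℝ) ∈ Set.Icc (0 : ℝ) 1 := by simp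
  have h1 : (1 : ℝ) ∈ Set.Icc (0 : ℝ) 1 := by simp
  have hside : ∀ t, H.comp (segmentSimplex hQ (w 0 h0 t) (w 1 h1 t))
      = segmentSimplex hK p (τ t) := fun t => by
    ext u
    have hu : u 0 + u 1 = 1 := by have := u.2.2; rwa [Fin.sum_univ_two] at this
    have e : segmentSimplex hQ (w 0 h0 t) (w 1 h1 t) u
        = w (u 1) ⟨u.2.1 1, by have := u.2.1 0; linarith [u.2.1 0, show u.1 0 = u 0 from rfl]⟩ t := by
      ext1
      rw [segmentSimplex_apply]
      ext1
      · simp [w]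
      · change u 0 • (t : Fin 2 → ℝ) + u 1 • (t : Fin 2 → ℝ) = t
        rw [← add_smul, hu, one_smul]
    rw [ContinuousMap.comp_apply, e, segmentSimplex_apply]
    change (1 - u 1) • (p : E) + u 1 • (τ t : E) = _
    rw [← hu, add_sub_cancel_right]
  have hline : ∀ s hs u, segmentSimplex hQ (w s hs (stdSimplex.vertex 0))
      (w s hs (stdSimplex.vertex 1)) u = w s hs u := fun s hs u => by
    have hu : u 0 + u 1 = 1 := by have := u.2.2; rwa [Fin.sum_univ_two] at this
    ext1
    rw [segmentSimplex_apply]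
    ext1
    · change u 0 * s + u 1 * s = s
      rw [← add_mul, hu, one_mul]
    · ext i
      fin_cases i <;> simp [w]
  have hbot : H.comp (segmentSimplex hQ (w 0 h0 (stdSimplex.vertex 0))
      (w 0 h0 (stdSimplex.vertex 1))) = segmentSimplex hK p p := by
    ext u
    have hu : u 0 + u 1 = 1 := by have := u.2.2; rwa [Fin.sum_univ_two] at this
    rw [ContinuousMap.comp_apply, hline 0 h0, segmentSimplex_apply, ← add_smul, hu]
    simp [H, w]
  have htop : H.comp (segmentSimplex hQ (w 1 h1 (stdSimplex.vertex 0))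
      (w 1 h1 (stdSimplex.vertex 1))) = τ := by
    ext u
    rw [ContinuousMap.comp_apply, hline 1 h1]
    simp [H, w]
    rfl
  -- The diagonal of the square is computed from the two triangles on either side of it; the bottom
  -- edge is constant and contributes zero.
  have e1 := cocycle_segment_add c hQ (f.comp H) (w 0 h0 (stdSimplex.vertex 0))
    (w 0 h0 (stdSimplex.vertex 1)) (w 1 h1 (stdSimplex.vertex 1))
  have e2 := cocycle_segment_add c hQ (f.comp H) (w 0 h0 (stdSimplex.vertex 0))
    (w 1 h1 (stdSimplex.vertex 0)) (w 1 h1 (stdSimplex.vertex 1))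
  simp only [ContinuousMap.comp_assoc, hside, hbot, htop, cocycle_segment_self, zero_add] at e1 e2
  rw [Simplex.vertex, Simplex.vertex, e1, ← e2, add_sub_cancel_left]

lemma eq_of_eventually_eq {Y B : Type*} [TopologicalSpace Y] [PreconnectedSpace Y] {φ : Y → B}
    (h : ∀ p, ∀ᶠ q in nhds p, φ q = φ p) (p q : Y) : φ p = φ q :=
  (IsLocallyConstant.iff_eventually_eq φ |>.2 h).apply_eq_of_preconnectedSpace p q

lemma preconnectedSpace_of_convex (hK : Convex ℝ K) : PreconnectedSpace K :=
  Subtype.preconnectedSpace hK.isPreconnected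

instance (n : ℕ) : PreconnectedSpace (stdSimplex ℝ (Fin n)) :=
  preconnectedSpace_of_convex (convex_stdSimplex ℝ (Fin n))

/-- A cocycle that vanishes on all small simplices vanishes. -/
lemma cocycle_eq_zero_of_small (c : Cocycle1 X A)
    (h : ∀ x, ∃ U ∈ nhds x, ∀ σ : Simplex X 1, Set.range σ ⊆ U → c.1 σ = 0) : c = 0 := by
  refine Subtype.ext (funext fun σ => ?_)
  have hK := convex_stdSimplex ℝ (Fin 2)
  -- The value on the initial piece of `σ` ending at `p` is locally constant in `p`: moving to a
  -- nearby `q` changes it by the value on a small segment.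
  have key : ∀ p q : stdSimplex ℝ (Fin 2), c.1 (σ.comp (segmentSimplex hK (stdSimplex.vertex 0) p))
      = c.1 (σ.comp (segmentSimplex hK (stdSimplex.vertex 0) q)) := by
    refine eq_of_eventually_eq
      (φ := fun p => c.1 (σ.comp (segmentSimplex hK (stdSimplex.vertex 0) p))) fun p => ?_
    obtain ⟨U, hU, hc⟩ := h (σ p)
    obtain ⟨r, hr, hrU⟩ := Metric.mem_nhds_iff.1 (σ.continuous.continuousAt hU)
    filter_upwards [Metric.ball_mem_nhds p hr] with q hq
    rw [← sub_eq_zero, cocycle_segment_sub]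
    apply hc
    rintro _ ⟨t, rfl⟩
    refine hrU ?_
    exact (convex_ball (p : Fin 2 → ℝ) r).segment_subset (Metric.mem_ball_self hr) hq
      (segmentSimplex_mem_segment hK p q t)
  have := key (stdSimplex.vertex 0) (stdSimplex.vertex 1)
  rw [cocycle_segment_self, comp_segmentSimplex_vertex] at this
  exact this.symm

end Affine

/-! ### Systems of local primitives and the cocycles they determine -/

section Germs

open Filter Topology

variable {X : Type*} [TopologicalSpace X] {A : Type*} [AddCommGroup A]
variable {E : Type*} [NormedAddCommGroup E] [NormedSpace ℝ E] {K : Set E}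

/-- A family of functions, one around each point, that locally differ by constants. -/
def IsGermSystem (F : X → X → A) : Prop :=
  ∀ x, ∀ᶠ y in 𝓝 x, ∀ᶠ z in 𝓝 y, F x z - F x y = F y z - F y y

/-- A function that locally differs by constants from the members of a system of germs. -/
def IsGlobalPrimitive (F : X → X → A) (φ : X → A) : Prop :=
  ∀ x, ∀ᶠ y in 𝓝 x, φ y - φ x = F x y - F x x

lemma IsGermSystem.comp {F : X → X → A} (hF : IsGermSystem F) {Y : Type*} [TopologicalSpace Y]
    (f : C(Y, X)) : IsGermSystem fun p q => F (f p) (f q) := fun p => by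
  filter_upwards [f.continuous.continuousAt.eventually (hF (f p))] with q hq
  exact f.continuous.continuousAt.eventually hq

lemma IsGlobalPrimitive.comp {F : X → X → A} {φ : X → A} (hφ : IsGlobalPrimitive F φ)
    {Y : Type*} [TopologicalSpace Y] (f : C(Y, X)) :
    IsGlobalPrimitive (fun p q => F (f p) (f q)) (φ ∘ f) := fun p =>
  f.continuous.continuousAt.eventually (hφ (f p))

/-- The function `φ - ψ` is locally constant. -/
lemma IsGlobalPrimitive.sub_eq [PreconnectedSpace X] {F : X → X → A} {φ ψ : X → A}
    (hφ : IsGlobalPrimitive F φ) (hψ : IsGlobalPrimitive F ψ) (x y : X) :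
    φ y - φ x = ψ y - ψ x := by
  have key := eq_of_eventually_eq (φ := fun z => φ z - ψ z) (fun p => by
    filter_upwards [hφ p, hψ p] with q h1 h2
    exact sub_eq_sub_iff_sub_eq_sub.1 (h1.trans h2.symm)) x y
  exact sub_eq_sub_iff_sub_eq_sub.1 key.symm

/-- On a compact convex set every system of germs has a global primitive. -/
lemma IsGermSystem.exists_isGlobalPrimitive (hK : Convex ℝ K) (hc : IsCompact K)
    {G : K → K → A} (hG : IsGermSystem G) : ∃ φ, IsGlobalPrimitive G φ := by
  have : CompactSpace K := isCompact_iff_compactSpace.1 hc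
  rcases isEmpty_or_nonempty K with hE | ⟨⟨p₀⟩⟩
  · exact ⟨fun _ => 0, fun p => (hE.false p).elim⟩
  have hr : ∀ p, ∃ r > 0, ∀ q ∈ Metric.ball p r, ∀ᶠ z in 𝓝 q, G p z - G p q = G q z - G q q :=
    fun p => Metric.eventually_nhds_iff_ball.1 (hG p)
  choose r hr0 hr using hr
  -- The part of `K` in two balls is convex, hence connected, so local agreement of increments gives
  -- agreement on the whole overlap.
  have hdiff : ∀ p p' a b : K, a ∈ Metric.ball p (r p) → b ∈ Metric.ball p (r p) →
      a ∈ Metric.ball p' (r p') → b ∈ Metric.ball p' (r p') →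
      G p b - G p a = G p' b - G p' a := by
    intro p p' a b ha hb ha' hb'
    let C : Set E := K ∩ (Metric.ball p (r p) ∩ Metric.ball p' (r p'))
    have hC : Convex ℝ C := hK.inter ((convex_ball _ _).inter (convex_ball _ _))
    have := preconnectedSpace_of_convex hC
    have key := eq_of_eventually_eq
      (φ := fun z : C => G p ⟨z, z.2.1⟩ - G p' ⟨z, z.2.1⟩) (fun z => by
        have hcont : Continuous fun z : C => (⟨z, z.2.1⟩ : K) := by fun_prop
        filter_upwards [hcont.continuousAt.eventually (hr p ⟨z, z.2.1⟩ z.2.2.1),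
          hcont.continuousAt.eventually (hr p' ⟨z, z.2.1⟩ z.2.2.2)] with w h1 h2
        exact sub_eq_sub_iff_sub_eq_sub.1 (h1.trans h2.symm)) ⟨a, a.2, ha, ha'⟩ ⟨b, b.2, hb, hb'⟩
    exact sub_eq_sub_iff_sub_eq_sub.1 key.symm
  obtain ⟨δ, hδ, hleb⟩ := lebesgue_number_lemma_of_metric (isCompact_univ (X := K))
    (c := fun p => Metric.ball p (r p)) (fun p => Metric.isOpen_ball)
    (fun p _ => Set.mem_iUnion.2 ⟨p, Metric.mem_ball_self (hr0 p)⟩)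
  choose P hP using fun a => hleb a (Set.mem_univ a)
  -- The increment from `a` to `b`, meaningful when their distance is below the Lebesgue number `δ`.
  let w : K → K → A := fun a b => G (P a) b - G (P a) a
  have hw : ∀ a b c, dist b a < δ → dist c a < δ → dist c b < δ → w a b + w b c = w a c := by
    intro a b c hba hca hcb
    have h := hdiff (P b) (P a) b c (hP b (Metric.mem_ball_self hδ)) (hP b hcb) (hP a hba)
      (hP a hca)
    change _ + (G (P b) c - G (P b) b) = _
    rw [h]
    change G (P a) b - G (P a) a + (G (P a) c - G (P a) b) = G (P a) c - G (P a) a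
    abel
  obtain ⟨R, hR⟩ := hc.isBounded.subset_closedBall (p₀ : E)
  obtain ⟨n, hn⟩ := exists_nat_gt (R / (δ / 2))
  have hn0 : 0 < (n : ℝ) := by
    refine lt_of_le_of_lt (div_nonneg ?_ (by positivity)) hn
    simpa using hR p₀.2
  -- The point at fraction `k / n` of the segment from `p₀` to `a`; the choice of `n` makes each
  -- step shorter than `δ / 2`. The value for `k > n` is a dummy.
  let s : ℕ → K → K := fun k a => if hk : k ≤ n then
    ⟨(p₀ : E) + ((k : ℝ) / n) • ((a : E) - p₀), hK.add_smul_sub_mem p₀.2 a.2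
      ⟨by positivity, div_le_one_of_le₀ (by exact_mod_cast hk) hn0.le⟩⟩ else a
  have hs : ∀ k ≤ n, ∀ a, (s k a : E) = (p₀ : E) + ((k : ℝ) / n) • ((a : E) - p₀) :=
    fun k hk a => by simp [s, hk]
  have hs0 : ∀ a, s 0 a = p₀ := fun a => by ext1; rw [hs 0 (Nat.zero_le _)]; simp
  have hsn : ∀ a, s n a = a := fun a => by ext1; rw [hs n le_rfl, div_self hn0.ne']; simp
  have hstep : ∀ k < n, ∀ a, dist (s (k + 1) a) (s k a) < δ / 2 := fun k hk a => by
    rw [Subtype.dist_eq, hs _ hk, hs _ hk.le, dist_add_left, dist_eq_norm, ← sub_smul, norm_smul]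
    have e : ((k + 1 : ℕ) : ℝ) / n - (k : ℝ) / n = 1 / n := by push_cast; ring
    have h1 : ‖(a : E) - p₀‖ ≤ R := by simpa [dist_eq_norm] using hR a.2
    rw [e, Real.norm_of_nonneg (by positivity), one_div, inv_mul_lt_iff₀ hn0]
    calc _ ≤ R := h1
      _ < n * (δ / 2) := (div_lt_iff₀ (by positivity)).1 hn
  have hlevel : ∀ k ≤ n, ∀ a b, dist (s k b) (s k a) ≤ dist b a := fun k hk a b => by
    rw [Subtype.dist_eq, hs _ hk, hs _ hk, dist_add_left, dist_eq_norm, ← smul_sub,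
      sub_sub_sub_cancel_right, norm_smul, Subtype.dist_eq, dist_eq_norm]
    refine mul_le_of_le_one_left (norm_nonneg _) ?_
    rw [Real.norm_of_nonneg (by positivity)]
    exact div_le_one_of_le₀ (by exact_mod_cast hk) hn0.le
  let φ : ℕ → K → A := fun k a => ∑ j ∈ Finset.range k, w (s j a) (s (j + 1) a)
  -- Two neighbouring segments from `p₀` form a ladder. Each rung-to-rung quadrilateral is cut into
  -- two triangles, whose diagonal is shorter than `δ` because the sides are shorter than `δ / 2`.
  have hladder : ∀ a b, dist b a < δ / 2 → ∀ k ≤ n, φ k b - φ k a = w (s k a) (s k b) := by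
    intro a b hab k
    induction k with
    | zero =>
      intro _
      simp [φ, hs0, w]
    | succ k ih =>
      intro hk
      have hk' : k < n := hk
      have ih := ih hk'.le
      have d1 := hstep k hk' a
      have d2 := hstep k hk' b
      have d3 := (hlevel k hk'.le a b).trans_lt hab
      have d4 := (hlevel (k + 1) hk a b).trans_lt hab
      have d5 : dist (s (k + 1) b) (s k a) < δ := by
        linarith [dist_triangle (s (k + 1) b) (s k b) (s k a)]
      have e1 := hw (s k a) (s k b) (s (k + 1) b) (by linarith) d5 (by linarith)
      have e2 := hw (s k a) (s (k + 1) a) (s (k + 1) b) (by linarith) d5 (by linarith)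
      simp only [φ, Finset.sum_range_succ] at ih ⊢
      rw [add_sub_add_comm, ih, ← add_sub_assoc, e1, ← e2, add_sub_cancel_left]
  refine ⟨φ n, fun a => ?_⟩
  filter_upwards [Metric.ball_mem_nhds a (half_pos hδ), hr (P a) a (hP a (Metric.mem_ball_self hδ))]
    with b hb hb'
  rw [hladder a b hb n le_rfl, hsn, hsn, ← hb']

/-- A system of germs determines a cocycle. -/
lemma IsGermSystem.exists_cocycle {F : X → X → A} (hF : IsGermSystem F) :
    ∃ c : Cocycle1 X A, ∀ x, ∀ U : Set X,
      (∀ y ∈ U, ∀ᶠ z in 𝓝 y, F x z - F x y = F y z - F y y) →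
      ∀ σ : Simplex X 1, Set.range σ ⊆ U →
        c.1 σ = F x (σ.vertex 1) - F x (σ.vertex 0) := by
  have hex : ∀ (n : ℕ) (σ : Simplex X n),
      ∃ φ, IsGlobalPrimitive (fun p q => F (σ p) (σ q)) φ := fun n σ =>
    (hF.comp σ).exists_isGlobalPrimitive (convex_stdSimplex ℝ _) (isCompact_stdSimplex ℝ _)
  choose φ hφ using hex
  -- The germs are pulled back to each simplex, where a global primitive exists; its increment does
  -- not depend on the choice of primitive.
  let c : Simplex X 1 → A := fun σ => φ 1 σ (stdSimplex.vertex 1) - φ 1 σ (stdSimplex.vertex 0)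
  have hc : ∀ (σ : Simplex X 1) (ψ), IsGlobalPrimitive (fun p q => F (σ p) (σ q)) ψ →
      c σ = ψ (stdSimplex.vertex 1) - ψ (stdSimplex.vertex 0) := fun σ ψ hψ =>
    (hφ 1 σ).sub_eq hψ _ _
  refine ⟨Cocycle1.mk c fun σ => ?_, fun x U hU σ hσ => ?_⟩
  -- A primitive on the 2-simplex restricts to a primitive on each face, so the three increments
  -- telescope.
  · have hface : ∀ i : Fin 3, c (σ.face i)
        = φ 2 σ (stdSimplex.vertex (i.succAbove 1)) - φ 2 σ (stdSimplex.vertex (i.succAbove 0)) :=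
      fun i => by
        rw [hc (σ.face i) _ ((hφ 2 σ).comp ⟨stdSimplex.map i.succAbove,
          stdSimplex.continuous_map _⟩)]
        simp
    rw [hface, hface, hface]
    change φ 2 σ (stdSimplex.vertex 1) - φ 2 σ (stdSimplex.vertex 0)
      + (φ 2 σ (stdSimplex.vertex 2) - φ 2 σ (stdSimplex.vertex 1))
      = φ 2 σ (stdSimplex.vertex 2) - φ 2 σ (stdSimplex.vertex 0)
    abel
  · exact hc σ (fun p => F x (σ p)) fun p =>
      σ.continuous.continuousAt.eventually (hU (σ p) (hσ ⟨p, rfl⟩))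

end Germs

/-! ### Parametrization of affine segments -/

section Paths

variable {X : Type*} [TopologicalSpace X]

lemma stdSimplexHomeomorphUnitInterval_symm_apply (t : unitInterval) :
    (stdSimplexHomeomorphUnitInterval.symm t).1 = ![1 - (t : ℝ), t] := rfl

lemma segment_path {K : Set (EuclideanSpace ℝ (Fin 2))} (hK : Convex ℝ K) (f : C(K, X)) (p q : K)
    {g : EuclideanSpace ℝ (Fin 2) → X} (hg : ∀ p : K, f p = g p) {t : ℝ}
    (ht : t ∈ Set.Icc (0 : ℝ) 1) :
    Simplex.path (f.comp (segmentSimplex hK p q)) t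
      = g ((1 - t) • (p : EuclideanSpace ℝ (Fin 2)) + t • (q : EuclideanSpace ℝ (Fin 2))) := by
  unfold Simplex.path
  rw [ContinuousMap.comp_apply, hg, segmentSimplex_apply]
  congr 3 <;> simp [Set.projIcc_of_mem _ ht] <;> rfl

end Paths

/-! ### Local primitives of forms and of cocycles on a surface -/

section Local

open Filter Topology

variable {M : Type*} [TopologicalSpace M] [ChartedSpace (EuclideanSpace ℝ (Fin 2)) M]

/-- The chart around `x` maps a neighbourhood of `x` onto a ball. -/
lemma exists_chart_ball (x : M) {U : Set M} (hU : U ∈ 𝓝 x) :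
    ∃ r > 0, Metric.ball (extChartAt (𝓡 2) x x) r ⊆ (extChartAt (𝓡 2) x).target ∧
      ∀ y ∈ Metric.ball (extChartAt (𝓡 2) x x) r, (extChartAt (𝓡 2) x).symm y ∈ U := by
  have h1 : (extChartAt (𝓡 2) x).target ∈ 𝓝 (extChartAt (𝓡 2) x x) :=
    (isOpen_extChartAt_target x).mem_nhds (mem_extChartAt_target x)
  have h2 : ∀ᶠ y in 𝓝 (extChartAt (𝓡 2) x x), (extChartAt (𝓡 2) x).symm y ∈ U := by
    refine (continuousAt_extChartAt_symm (I := 𝓡 2) x).eventually ?_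
    rwa [extChartAt_to_inv]
  obtain ⟨r, hr, h⟩ := Metric.mem_nhds_iff.1 (inter_mem h1 h2)
  exact ⟨r, hr, fun y hy => (h hy).1, fun y hy => (h hy).2⟩

lemma chart_preimage_mem_nhds (x : M) {B : Set (EuclideanSpace ℝ (Fin 2))} (hB : IsOpen B) :
    IsOpen ((extChartAt (𝓡 2) x).source ∩ extChartAt (𝓡 2) x ⁻¹' B) :=
  (continuousOn_extChartAt x).isOpen_inter_preimage (isOpen_extChartAt_source x) hB

/-- Locally, a cocycle is the coboundary of a function, and the function can be computed on
smooth simplices. -/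
lemma exists_local_primitive_of_cocycle [IsManifold (𝓡 2) ∞ M] {A : Type*} [AddCommGroup A]
    (c : Cocycle1 M A) (x : M) :
    ∃ U : Set M, IsOpen U ∧ x ∈ U ∧ ∃ F : M → A,
      (∀ σ : Simplex M 1, Set.range σ ⊆ U → c.1 σ = F (σ.vertex 1) - F (σ.vertex 0)) ∧
      ∀ y ∈ U, ∃ σ : Simplex M 1, σ.IsSmooth ∧ F y = c.1 σ := by
  classical
  obtain ⟨r, hr, hB, -⟩ := exists_chart_ball x (univ_mem)
  set φ := extChartAt (𝓡 2) x
  set B := Metric.ball (φ x) r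
  have hK : Convex ℝ B := convex_ball _ _
  let f : C(B, M) := ⟨fun p => φ.symm p,
    continuousOn_iff_continuous_domRestrict.1 ((continuousOn_extChartAt_symm x).mono hB)⟩
  let p₀ : B := ⟨φ x, Metric.mem_ball_self hr⟩
  -- The value of `c` on the segment, straight in the chart, from `x` to `y`. The value 0 off the
  -- ball is a dummy.
  let F : M → A := fun y => if h : φ y ∈ B then c.1 (f.comp (segmentSimplex hK p₀ ⟨φ y, h⟩)) else 0
  refine ⟨φ.source ∩ φ ⁻¹' B, chart_preimage_mem_nhds x Metric.isOpen_ball,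
    ⟨mem_extChartAt_source x, Metric.mem_ball_self hr⟩, F, fun σ hσ => ?_, fun y hy => ?_⟩
  · let τ : Simplex B 1 := ⟨fun t => ⟨φ (σ t), (hσ ⟨t, rfl⟩).2⟩, by
      refine Continuous.subtype_mk ?_ _
      exact (continuousOn_extChartAt x).comp_continuous σ.continuous fun t => (hσ ⟨t, rfl⟩).1⟩
    have hτ : f.comp τ = σ := by
      ext t
      exact φ.left_inv (hσ ⟨t, rfl⟩).1
    have hF : ∀ i, F (σ.vertex i) = c.1 (f.comp (segmentSimplex hK p₀ (τ.vertex i))) := fun i => by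
      have : φ (σ.vertex i) ∈ B := (hσ ⟨stdSimplex.vertex i, rfl⟩).2
      simp only [F, dif_pos this]
      rfl
    rw [hF, hF, ← cocycle_comp_eq c hK f p₀ τ, hτ]
  · refine ⟨f.comp (segmentSimplex hK p₀ ⟨φ y, hy.2⟩), ?_, dif_pos hy.2⟩
    have h1 : ContMDiffOn 𝓘(ℝ, ℝ) (𝓡 2) ∞
        (φ.symm ∘ fun t : ℝ => (1 - t) • φ x + t • φ y) (Set.Icc 0 1) := by
      refine (contMDiffOn_extChartAt_symm x).comp (t := φ.target) ?_ fun t ht => ?_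
      · rw [contMDiffOn_iff_contDiffOn]
        fun_prop
      · exact hB (hK p₀.2 hy.2 (sub_nonneg.2 ht.2) ht.1 (by ring))
    exact h1.congr fun t ht => segment_path hK f p₀ ⟨φ y, hy.2⟩ (g := φ.symm) (fun _ => rfl) ht

/-- A cocycle that vanishes on all smooth simplices vanishes. -/
lemma cocycle_eq_zero_of_smooth [IsManifold (𝓡 2) ∞ M] {A : Type*} [AddCommGroup A]
    (c : Cocycle1 M A) (h : ∀ σ : Simplex M 1, σ.IsSmooth → c.1 σ = 0) : c = 0 := by
  refine cocycle_eq_zero_of_small c fun x => ?_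
  obtain ⟨U, hU, hx, F, hF, hs⟩ := exists_local_primitive_of_cocycle c x
  refine ⟨U, hU.mem_nhds hx, fun σ hσ => ?_⟩
  have hF0 : ∀ i, F (σ.vertex i) = 0 := fun i => by
    obtain ⟨τ, hτ, e⟩ := hs _ (hσ ⟨stdSimplex.vertex i, rfl⟩)
    exact e.trans (h τ hτ)
  rw [hF σ hσ, hF0, hF0, sub_zero]

/-- Two functions with the same coboundary on an open set differ there by local constants. -/
lemma eventually_sub_eq_sub {A : Type*} [AddCommGroup A] {U : Set M} (hU : IsOpen U) {F G : M → A}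
    (h : ∀ σ : Simplex M 1, Set.range σ ⊆ U →
      F (σ.vertex 1) - F (σ.vertex 0) = G (σ.vertex 1) - G (σ.vertex 0)) {x : M} (hx : x ∈ U) :
    ∀ᶠ y in 𝓝 x, F y - F x = G y - G x := by
  obtain ⟨r, hr, hB, hBU⟩ := exists_chart_ball x (hU.mem_nhds hx)
  set φ := extChartAt (𝓡 2) x
  set B := Metric.ball (φ x) r
  have hK : Convex ℝ B := convex_ball _ _
  let f : C(B, M) := ⟨fun p => φ.symm p,
    continuousOn_iff_continuous_domRestrict.1 ((continuousOn_extChartAt_symm x).mono hB)⟩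
  let p₀ : B := ⟨φ x, Metric.mem_ball_self hr⟩
  filter_upwards [(chart_preimage_mem_nhds x Metric.isOpen_ball).mem_nhds
    (show x ∈ φ.source ∩ φ ⁻¹' B from ⟨mem_extChartAt_source x, Metric.mem_ball_self hr⟩)] with y hy
  have := h (f.comp (segmentSimplex hK p₀ ⟨φ y, hy.2⟩)) (by
    rintro _ ⟨t, rfl⟩
    exact hBU _ (segmentSimplex hK p₀ ⟨φ y, hy.2⟩ t).2)
  rw [Simplex.vertex_comp, Simplex.vertex_comp, segmentSimplex_vertex_zero,
    segmentSimplex_vertex_one] at this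
  have e0 : f p₀ = x := φ.left_inv (mem_extChartAt_source x)
  have e1 : f ⟨φ y, hy.2⟩ = y := φ.left_inv hy.1
  rwa [e0, e1] at this

/-- The function `F` has differential `η` on `U`. -/
def IsPrimitiveOn (η : CovectorField M) (F : M → ℂ) (U : Set M) : Prop :=
  ∀ y ∈ U, HasMFDerivAt (𝓡 2) 𝓘(ℝ, ℂ) F y (η y)

/-- All tangent spaces are by definition the model plane, so one vector can be fed to the covectors
at `y` and at `z`. -/
lemma CovectorField.congr_point (η : CovectorField M) {y z : M} (h : z = y)
    (v : EuclideanSpace ℝ (Fin 2)) : η z v = η y v := by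
  subst h; rfl

lemma minSmoothness_two_le : minSmoothness ℝ 2 ≤ (∞ : WithTop ℕ∞) := by
  rw [minSmoothness_of_isRCLikeNormedField]
  exact WithTop.coe_le_coe.2 (show (2 : ℕ∞) ≤ ⊤ from le_top)

variable [IsManifold (𝓡 2) ∞ M]

lemma hasFDerivAt_comp_chart_symm {η : CovectorField M} {F : M → ℂ} (x : M)
    {y : EuclideanSpace ℝ (Fin 2)} (hy : y ∈ (extChartAt (𝓡 2) x).target)
    (h : HasMFDerivAt (𝓡 2) 𝓘(ℝ, ℂ) F ((extChartAt (𝓡 2) x).symm y)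
      (η ((extChartAt (𝓡 2) x).symm y))) :
    HasFDerivAt (F ∘ (extChartAt (𝓡 2) x).symm) (η.inChart x y) y := by
  have h2 : MDifferentiableAt 𝓘(ℝ, EuclideanSpace ℝ (Fin 2)) (𝓡 2) (extChartAt (𝓡 2) x).symm y :=
    ((contMDiffOn_extChartAt_symm (n := ∞) x).contMDiffAt
      ((isOpen_extChartAt_target x).mem_nhds hy)).mdifferentiableAt (by simp)
  exact (h.comp y h2.hasMFDerivAt).hasFDerivAt

lemma mdifferentiableAt_chart {x y : M} (hy : y ∈ (extChartAt (𝓡 2) x).source) :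
    MDifferentiableAt (𝓡 2) 𝓘(ℝ, EuclideanSpace ℝ (Fin 2)) (extChartAt (𝓡 2) x) y :=
  (contMDiffAt_extChartAt' (n := ∞) (by rwa [extChartAt_source] at hy)).mdifferentiableAt (by simp)

lemma mfderiv_chart_symm_comp {x y : M} (hy : y ∈ (extChartAt (𝓡 2) x).source) :
    (mfderiv 𝓘(ℝ, EuclideanSpace ℝ (Fin 2)) (𝓡 2) (extChartAt (𝓡 2) x).symm
      (extChartAt (𝓡 2) x y)).comp
      (mfderiv (𝓡 2) 𝓘(ℝ, EuclideanSpace ℝ (Fin 2)) (extChartAt (𝓡 2) x) y)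
      = ContinuousLinearMap.id ℝ (TangentSpace (𝓡 2) y) := by
  have := mfderivWithin_extChartAt_symm_comp_mfderiv_extChartAt' (I := 𝓡 2) hy
  simpa [mfderivWithin_univ] using this

lemma mfderiv_chart_comp_symm {x : M} {y : EuclideanSpace ℝ (Fin 2)}
    (hy : y ∈ (extChartAt (𝓡 2) x).target) :
    (mfderiv (𝓡 2) 𝓘(ℝ, EuclideanSpace ℝ (Fin 2)) (extChartAt (𝓡 2) x)
      ((extChartAt (𝓡 2) x).symm y)).comp
      (mfderiv 𝓘(ℝ, EuclideanSpace ℝ (Fin 2)) (𝓡 2) (extChartAt (𝓡 2) x).symm y)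
      = ContinuousLinearMap.id ℝ (EuclideanSpace ℝ (Fin 2)) := by
  have := mfderiv_extChartAt_comp_mfderivWithin_extChartAt_symm (I := 𝓡 2) hy
  rwa [ModelWithCorners.range_eq_univ, mfderivWithin_univ] at this

lemma hasMFDerivAt_of_chart {η : CovectorField M} {f : EuclideanSpace ℝ (Fin 2) → ℂ} {x y : M}
    (hy : y ∈ (extChartAt (𝓡 2) x).source)
    (h : HasFDerivAt f (η.inChart x (extChartAt (𝓡 2) x y)) (extChartAt (𝓡 2) x y)) :
    HasMFDerivAt (𝓡 2) 𝓘(ℝ, ℂ) (f ∘ extChartAt (𝓡 2) x) y (η y) := by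
  have h1 := h.hasMFDerivAt.comp y (mdifferentiableAt_chart hy).hasMFDerivAt
  have e : (η.inChart x (extChartAt (𝓡 2) x y)).comp
      (mfderiv (𝓡 2) 𝓘(ℝ, EuclideanSpace ℝ (Fin 2)) (extChartAt (𝓡 2) x) y) = η y := by
    have h2 := mfderiv_chart_symm_comp hy
    ext v
    have h3 := DFunLike.congr_fun h2 v
    change η ((extChartAt (𝓡 2) x).symm (extChartAt (𝓡 2) x y)) _ = _
    exact (η.congr_point ((extChartAt (𝓡 2) x).left_inv hy) _).trans (congrArg (η y) h3)
  rw [← e]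
  exact h1

/-- Primitives of the same form differ by local constants. -/
lemma IsPrimitiveOn.eventually_sub_eq {η : CovectorField M} {F G : M → ℂ} {U V : Set M} {x : M}
    (hF : IsPrimitiveOn η F U) (hG : IsPrimitiveOn η G V) (hU : U ∈ 𝓝 x) (hV : V ∈ 𝓝 x) :
    ∀ᶠ y in 𝓝 x, F y - F x = G y - G x := by
  obtain ⟨r, hr, hB, hBU⟩ := exists_chart_ball x (inter_mem hU hV)
  set φ := extChartAt (𝓡 2) x
  set B := Metric.ball (φ x) r
  filter_upwards [(chart_preimage_mem_nhds x Metric.isOpen_ball).mem_nhds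
    (show x ∈ φ.source ∩ φ ⁻¹' B from ⟨mem_extChartAt_source x, Metric.mem_ball_self hr⟩)] with y hy
  have hd : ∀ z ∈ B, HasFDerivAt (F ∘ φ.symm - G ∘ φ.symm) 0 z := fun z hz => by
    have h := (hasFDerivAt_comp_chart_symm x (hB hz) (hF _ (hBU z hz).1)).sub
      (hasFDerivAt_comp_chart_symm x (hB hz) (hG _ (hBU z hz).2))
    rwa [sub_self] at h
  have h := Metric.isOpen_ball.is_const_of_fderiv_eq_zero (convex_ball _ _).isPreconnected
    (fun z hz => (hd z hz).differentiableAt.differentiableWithinAt)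
    (fun z hz => (hd z hz).fderiv) hy.2 (Metric.mem_ball_self hr : φ x ∈ B)
  change F (φ.symm (φ y)) - G (φ.symm (φ y)) = F (φ.symm (φ x)) - G (φ.symm (φ x)) at h
  rw [φ.left_inv hy.1, φ.left_inv (mem_extChartAt_source x)] at h
  exact sub_eq_sub_iff_sub_eq_sub.1 h

/-- A primitive of a smooth form is smooth. -/
lemma IsPrimitiveOn.contMDiffAt {η : A1 M} {F : M → ℂ} {U : Set M} {x : M}
    (hF : IsPrimitiveOn η.field F U) (hU : U ∈ 𝓝 x) : ContMDiffAt (𝓡 2) 𝓘(ℝ, ℂ) ∞ F x := by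
  obtain ⟨r, hr, hB, hBU⟩ := exists_chart_ball x hU
  have h : ∀ z ∈ Metric.ball (extChartAt (𝓡 2) x x) r,
      HasFDerivAt (F ∘ (extChartAt (𝓡 2) x).symm) (η.field.inChart x z) z :=
    fun z hz => hasFDerivAt_comp_chart_symm x (hB hz) (hF _ (hBU z hz))
  have hs : ContDiffOn ℝ ∞ (F ∘ (extChartAt (𝓡 2) x).symm)
      (Metric.ball (extChartAt (𝓡 2) x x) r) := by
    -- In the chart the derivative of `F` is the expression of `η`, which is already smooth.
    rw [contDiffOn_infty_iff_fderiv_of_isOpen Metric.isOpen_ball]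
    refine ⟨fun z hz => (h z hz).differentiableAt.differentiableWithinAt, ?_⟩
    exact ((η.smooth x).mono hB).congr fun z hz => (h z hz).fderiv
  have h2 : ContMDiffAt 𝓘(ℝ, EuclideanSpace ℝ (Fin 2)) 𝓘(ℝ, ℂ) ∞
      (F ∘ (extChartAt (𝓡 2) x).symm) (extChartAt (𝓡 2) x x) :=
    (hs.contDiffAt (Metric.ball_mem_nhds _ hr)).contMDiffAt
  have h3 := h2.comp x (contMDiffAt_extChartAt (n := ∞))
  refine h3.congr_of_eventuallyEq ?_
  filter_upwards [extChartAt_source_mem_nhds (I := 𝓡 2) x] with y hy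
  change F y = F ((extChartAt (𝓡 2) x).symm (extChartAt (𝓡 2) x y))
  rw [(extChartAt (𝓡 2) x).left_inv hy]

/-- The differential of the chart is onto, so nothing is lost by pulling the planar 2-form back to
the tangent space. -/
lemma d1_eq_zero_iff (η : A1 M) (x : M) : d1 η x = 0 ↔
    ∀ u v, fderiv ℝ (η.field.inChart x) (extChartAt (𝓡 2) x x) u v
      = fderiv ℝ (η.field.inChart x) (extChartAt (𝓡 2) x x) v u := by
  constructor
  · intro h u v
    have hs : ∀ w : EuclideanSpace ℝ (Fin 2), ∃ w' : TangentSpace (𝓡 2) x, chartDeriv x w' = w :=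
      fun w => by
        have := mfderiv_chart_comp_symm (mem_extChartAt_target (I := 𝓡 2) x)
        rw [extChartAt_to_inv] at this
        exact ⟨_, DFunLike.congr_fun this w⟩
    obtain ⟨u', rfl⟩ := hs u
    obtain ⟨v', rfl⟩ := hs v
    have h1 := d1_apply η x ![u', v']
    rw [h, planeDeriv_apply (differentiableAt_inChart η x)] at h1
    exact sub_eq_zero.1 h1.symm
  · intro h
    ext v
    rw [d1_apply, planeDeriv_apply (differentiableAt_inChart η x), h, sub_self]
    rfl

/-- A form with smooth local primitives is smooth. -/
lemma contDiffOn_inChart_of_local {η : CovectorField M}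
    (h : ∀ x, ∃ U ∈ 𝓝 x, ∃ F, IsPrimitiveOn η F U ∧ ContMDiffOn (𝓡 2) 𝓘(ℝ, ℂ) ∞ F U) (x : M) :
    ContDiffOn ℝ ∞ (η.inChart x) (extChartAt (𝓡 2) x).target ∧
    ∀ y ∈ (extChartAt (𝓡 2) x).target, ∀ u v, fderiv ℝ (η.inChart x) y u v
      = fderiv ℝ (η.inChart x) y v u := by
  have key : ∀ y ∈ (extChartAt (𝓡 2) x).target, ∃ f : EuclideanSpace ℝ (Fin 2) → ℂ,
      ContDiffAt ℝ ∞ f y ∧ η.inChart x =ᶠ[𝓝 y] fderiv ℝ f := by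
    intro y hy
    obtain ⟨U, hU, F, hF, hs⟩ := h ((extChartAt (𝓡 2) x).symm y)
    have hsymm := (contMDiffOn_extChartAt_symm (I := 𝓡 2) (n := ∞) x).contMDiffAt
      ((isOpen_extChartAt_target x).mem_nhds hy)
    refine ⟨F ∘ (extChartAt (𝓡 2) x).symm, ?_, ?_⟩
    · exact ((hs.contMDiffAt hU).comp y hsymm).contDiffAt
    · filter_upwards [(isOpen_extChartAt_target (I := 𝓡 2) x).mem_nhds hy,
        hsymm.continuousAt.eventually hU] with z hz hzU
      exact (hasFDerivAt_comp_chart_symm x hz (hF _ hzU)).fderiv.symm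
  constructor
  · intro y hy
    obtain ⟨f, hf, e⟩ := key y hy
    exact ((hf.fderiv_right (m := ∞) (by simp)).congr_of_eventuallyEq e).contDiffWithinAt
  · intro y hy u v
    obtain ⟨f, hf, e⟩ := key y hy
    rw [e.fderiv_eq]
    exact (hf.isSymmSndFDerivAt minSmoothness_two_le) u v

/-- A form with smooth local primitives is a closed form. -/
lemma exists_closed_of_local {η : CovectorField M}
    (h : ∀ x, ∃ U ∈ 𝓝 x, ∃ F, IsPrimitiveOn η F U ∧ ContMDiffOn (𝓡 2) 𝓘(ℝ, ℂ) ∞ F U) :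
    ∃ θ : Z1 M, (θ : A1 M).field = η :=
  ⟨⟨A1.mk η fun x => (contDiffOn_inChart_of_local h x).1, fun x =>
    (d1_eq_zero_iff _ x).2 ((contDiffOn_inChart_of_local h x).2 _ (mem_extChartAt_target x))⟩, rfl⟩

lemma isPrimitiveOn_d0 (f : A0 M) : IsPrimitiveOn (d0 f).field f Set.univ := fun y _ =>
  (f.contMDiff.mdifferentiableAt (x := y) (by simp)).hasMFDerivAt

lemma d1_d0 (f : A0 M) (x : M) : d1 (d0 f) x = 0 :=
  (d1_eq_zero_iff _ x).2 ((contDiffOn_inChart_of_local (fun _ =>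
    ⟨Set.univ, univ_mem, f, isPrimitiveOn_d0 f, f.contMDiff.contMDiffOn⟩) x).2 _
      (mem_extChartAt_target x))

/-- A closed form has a symmetric derivative at every point of every chart. -/
lemma fderiv_inChart_symm (η : Z1 M) (x : M) {y : EuclideanSpace ℝ (Fin 2)}
    (hy : y ∈ (extChartAt (𝓡 2) x).target) (u v : EuclideanSpace ℝ (Fin 2)) :
    fderiv ℝ (η.1.field.inChart x) y u v = fderiv ℝ (η.1.field.inChart x) y v u := by
  -- `d1` tests symmetry only at the centre of each chart. At `y` one therefore passes to the chart
  -- centred at the corresponding point `p`, through the transition map `T`.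
  set p := (extChartAt (𝓡 2) x).symm y
  set w := η.1.field.inChart p
  set T := extChartAt (𝓡 2) p ∘ (extChartAt (𝓡 2) x).symm
  have hsymm : ∀ z ∈ (extChartAt (𝓡 2) x).target,
      ContMDiffAt 𝓘(ℝ, EuclideanSpace ℝ (Fin 2)) (𝓡 2) ∞ (extChartAt (𝓡 2) x).symm z := fun z hz =>
    (contMDiffOn_extChartAt_symm x).contMDiffAt ((isOpen_extChartAt_target x).mem_nhds hz)
  have hTs : ContDiffAt ℝ ∞ T y :=
    (ContMDiffAt.comp y (contMDiffAt_extChartAt (I := 𝓡 2) (x := p)) (hsymm y hy)).contDiffAt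
  have e : η.1.field.inChart x =ᶠ[𝓝 y] fun z => (w (T z)).comp (fderiv ℝ T z) := by
    filter_upwards [(isOpen_extChartAt_target (I := 𝓡 2) x).mem_nhds hy,
      (hsymm y hy).continuousAt.eventually (extChartAt_source_mem_nhds (I := 𝓡 2) p)] with z hz hzp
    have h1 : fderiv ℝ T z = (mfderiv (𝓡 2) 𝓘(ℝ, EuclideanSpace ℝ (Fin 2)) (extChartAt (𝓡 2) p)
        ((extChartAt (𝓡 2) x).symm z)).comp
        (mfderiv 𝓘(ℝ, EuclideanSpace ℝ (Fin 2)) (𝓡 2) (extChartAt (𝓡 2) x).symm z) := by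
      rw [← mfderiv_eq_fderiv]
      exact mfderiv_comp z (mdifferentiableAt_chart hzp)
        ((hsymm z hz).mdifferentiableAt (by simp))
    have h2 := mfderiv_chart_symm_comp hzp
    rw [h1]
    ext v
    set q := (extChartAt (𝓡 2) x).symm z
    set v' : TangentSpace (𝓡 2) q :=
      mfderiv 𝓘(ℝ, EuclideanSpace ℝ (Fin 2)) (𝓡 2) (extChartAt (𝓡 2) x).symm z v
    have h3 := DFunLike.congr_fun h2 v'
    change η.1.field q v' = η.1.field ((extChartAt (𝓡 2) p).symm (extChartAt (𝓡 2) p q)) _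
    exact ((η.1.field.congr_point ((extChartAt (𝓡 2) p).left_inv hzp) _).trans
      (congrArg (η.1.field q) h3)).symm
  have hw : HasFDerivAt w (fderiv ℝ w (T y)) (T y) :=
    (differentiableAt_inChart η.1 p).hasFDerivAt
  have hTd : HasFDerivAt T (fderiv ℝ T y) y := (hTs.differentiableAt (by simp)).hasFDerivAt
  have hT2 : HasFDerivAt (fderiv ℝ T) (fderiv ℝ (fderiv ℝ T) y) y :=
    ((hTs.fderiv_right (m := 1) (by norm_cast)).differentiableAt (by simp)).hasFDerivAt
  have hd : HasFDerivAt (fun z => (w (T z)).comp (fderiv ℝ T z)) _ y :=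
    (hw.comp y hTd).clm_comp hT2
  have hsym := hTs.isSymmSndFDerivAt minSmoothness_two_le
  have hclosed := (d1_eq_zero_iff η.1 p).1 (η.2 p)
  rw [e.fderiv_eq, hd.fderiv]
  -- The derivative of the pullback has two terms: one is symmetric by the symmetry of the second
  -- derivative of `T`, the other by closedness at the centre of the chart around `p`.
  change w (T y) (fderiv ℝ (fderiv ℝ T) y u v)
      + fderiv ℝ w (T y) (fderiv ℝ T y u) (fderiv ℝ T y v)
    = w (T y) (fderiv ℝ (fderiv ℝ T) y v u)
      + fderiv ℝ w (T y) (fderiv ℝ T y v) (fderiv ℝ T y u)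
  rw [hsym u v]
  congr 1
  exact hclosed _ _

/-- The Poincaré lemma: a closed form has local primitives. -/
lemma exists_isPrimitiveOn (η : Z1 M) (x : M) :
    ∃ U, IsOpen U ∧ x ∈ U ∧ ∃ F, IsPrimitiveOn η.1.field F U := by
  obtain ⟨r, hr, hB, -⟩ := exists_chart_ball x univ_mem
  obtain ⟨f, hf⟩ := Convex.exists_forall_hasFDerivAt_of_fderiv_symmetric
    (convex_ball (extChartAt (𝓡 2) x x) r) Metric.isOpen_ball (((η.1.smooth x).mono hB).differentiableOn (by simp))
    (fun a ha u v => fderiv_inChart_symm η x (hB ha) u v)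
  exact ⟨_, chart_preimage_mem_nhds x Metric.isOpen_ball,
    ⟨mem_extChartAt_source x, Metric.mem_ball_self hr⟩, f ∘ extChartAt (𝓡 2) x,
    fun y hy => hasMFDerivAt_of_chart hy.1 (hf _ hy.2)⟩

end Local

/-! ### The cocycle of periods of a closed form -/

section PeriodCocycle

open Filter Topology

variable {M : Type*} [TopologicalSpace M] [ChartedSpace (EuclideanSpace ℝ (Fin 2)) M]

/-- The cocycle `c` is given locally by differences of values of primitives of `η`. -/
def IsPeriod (η : A1 M) (c : Cocycle1 M ℂ) : Prop :=
  ∀ x, ∃ U, IsOpen U ∧ x ∈ U ∧ ∃ F, IsPrimitiveOn η.field F U ∧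
    ∀ σ : Simplex M 1, Set.range σ ⊆ U → c.1 σ = F (σ.vertex 1) - F (σ.vertex 0)

lemma IsPeriod.add {η θ : A1 M} {c e : Cocycle1 M ℂ} (hη : IsPeriod η c) (hθ : IsPeriod θ e) :
    IsPeriod (η + θ) (c + e) := fun x => by
  obtain ⟨U, hU, hxU, F, hF, hc⟩ := hη x
  obtain ⟨V, hV, hxV, G, hG, he⟩ := hθ x
  refine ⟨U ∩ V, hU.inter hV, ⟨hxU, hxV⟩, F + G, fun y hy => (hF y hy.1).add (hG y hy.2),
    fun σ hσ => ?_⟩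
  change c.1 σ + e.1 σ = _
  rw [hc σ (hσ.trans Set.inter_subset_left), he σ (hσ.trans Set.inter_subset_right)]
  exact sub_add_sub_comm _ _ _ _

lemma hasMFDerivAt_of_eventually_sub_eq {F G : M → ℂ} {x : M}
    {L : TangentSpace (𝓡 2) x →L[ℝ] ℂ} (hF : HasMFDerivAt (𝓡 2) 𝓘(ℝ, ℂ) F x L)
    (h : ∀ᶠ y in 𝓝 x, G y - G x = F y - F x) : HasMFDerivAt (𝓡 2) 𝓘(ℝ, ℂ) G x L := by
  refine ((hF.add (hasMFDerivAt_const (G x - F x) x)).congr_mfderiv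
    (add_zero _)).congr_of_eventuallyEq ?_
  filter_upwards [h] with y hy
  simp only [Pi.add_apply]
  linear_combination hy

variable [IsManifold (𝓡 2) ∞ M]

/-- The primitives from the Poincaré lemma form a system of germs, because two primitives of one
form differ by local constants. -/
lemma exists_isPeriod (η : Z1 M) : ∃ c, IsPeriod η.1 c := by
  choose U hU hx F hF using exists_isPrimitiveOn η
  have hloc : ∀ x, ∀ y ∈ U x, ∀ᶠ z in 𝓝 y, F x z - F x y = F y z - F y y := fun x y hy =>
    (hF x).eventually_sub_eq (hF y) ((hU x).mem_nhds hy) ((hU y).mem_nhds (hx y))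
  have hG : IsGermSystem F := fun x => by
    filter_upwards [(hU x).mem_nhds (hx x)] with y hy
    exact hloc x y hy
  obtain ⟨c, hc⟩ := hG.exists_cocycle
  exact ⟨c, fun x => ⟨U x, hU x, hx x, F x, hF x, fun σ hσ => hc x (U x) (hloc x) σ hσ⟩⟩

/-- Near each point both cocycles are increments of primitives of the same form, so they agree on
small simplices. -/
lemma IsPeriod.unique {η : A1 M} {c e : Cocycle1 M ℂ} (hc : IsPeriod η c) (he : IsPeriod η e) :
    c = e := by
  rw [← sub_eq_zero]
  refine cocycle_eq_zero_of_small _ fun x => ?_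
  obtain ⟨U, hU, hxU, F, hF, hc⟩ := hc x
  obtain ⟨V, hV, hxV, G, hG, he⟩ := he x
  refine ⟨_, inter_mem (inter_mem (hU.mem_nhds hxU) (hV.mem_nhds hxV))
    (hF.eventually_sub_eq hG (hU.mem_nhds hxU) (hV.mem_nhds hxV)), fun σ hσ => ?_⟩
  change c.1 σ - e.1 σ = 0
  have h : ∀ i, F (σ.vertex i) - F x = G (σ.vertex i) - G x := fun i => (hσ ⟨_, rfl⟩).2
  rw [hc σ fun y hy => (hσ hy).1.1, he σ fun y hy => (hσ hy).1.2]
  linear_combination h 1 - h 0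

/-- The cocycle of periods of a form is given on smooth simplices by integration. -/
lemma IsPeriod.eq_integral {η : A1 M} {c : Cocycle1 M ℂ} (hc : IsPeriod η c) {σ : Simplex M 1}
    (hσ : σ.IsSmooth) : c.1 σ = integral η σ := by
  have hK := convex_stdSimplex ℝ (Fin 2)
  let P : ℝ → stdSimplex ℝ (Fin 2) :=
    fun t => stdSimplexHomeomorphUnitInterval.symm (Set.projIcc 0 1 zero_le_one t)
  have hP : Continuous P :=
    stdSimplexHomeomorphUnitInterval.symm.continuous.comp continuous_projIcc
  -- The value of `c` on the part of `σ` up to time `t`. Locally it is a primitive of `η` along the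
  -- path plus a constant, so the fundamental theorem of calculus applies.
  let φ : ℝ → ℂ := fun t => c.1 (σ.comp (segmentSimplex hK (stdSimplex.vertex 0) (P t)))
  have key : ∀ t, ∃ U, IsOpen U ∧ σ.path t ∈ U ∧ ∃ F, IsPrimitiveOn η.field F U ∧
      ∀ᶠ s in 𝓝 t, φ s = F (σ.path s) + (φ t - F (σ.path t)) := by
    intro t
    obtain ⟨U, hU, hxU, F, hF, hc⟩ := hc (σ.path t)
    refine ⟨U, hU, hxU, F, hF, ?_⟩
    obtain ⟨r, hr, hrU⟩ := Metric.mem_nhds_iff.1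
      (σ.continuous.continuousAt (x := P t) (hU.mem_nhds hxU))
    filter_upwards [hP.continuousAt.eventually (Metric.ball_mem_nhds (P t) hr)] with s hs
    rw [add_sub_left_comm, ← sub_eq_iff_eq_add']
    simp only [φ]
    rw [cocycle_segment_sub, hc, Simplex.vertex_comp, Simplex.vertex_comp,
      segmentSimplex_vertex_zero, segmentSimplex_vertex_one]
    · rfl
    · rintro _ ⟨u, rfl⟩
      exact hrU ((convex_ball (P t : Fin 2 → ℝ) r).segment_subset (Metric.mem_ball_self hr) hs
        (segmentSimplex_mem_segment hK _ _ u))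
  have hsmooth : ContDiffOn ℝ 1 φ (Set.Icc 0 1) := by
    intro t ht
    obtain ⟨U, hU, hxU, F, hF, e⟩ := key t
    have h1 : ContMDiffWithinAt 𝓘(ℝ, ℝ) 𝓘(ℝ, ℂ) ∞ (F ∘ σ.path) (Set.Icc 0 1) t :=
      (hF.contMDiffAt (hU.mem_nhds hxU)).comp_contMDiffWithinAt t (hσ t ht)
    have h2 := (h1.contDiffWithinAt.of_le (m := 1) (by simp)).add
      (contDiffWithinAt_const (c := φ t - F (σ.path t)))
    exact h2.congr_of_eventuallyEq (e.filter_mono nhdsWithin_le_nhds) e.self_of_nhds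
  have hderiv : ∀ t ∈ Set.Icc (0 : ℝ) 1, derivWithin φ (Set.Icc 0 1) t
      = η.field (σ.path t) (mfderivWithin 𝓘(ℝ, ℝ) (𝓡 2) σ.path (Set.Icc 0 1) t (1 : ℝ)) := by
    intro t ht
    obtain ⟨U, hU, hxU, F, hF, e⟩ := key t
    have h1 := (hF _ hxU).comp_hasMFDerivWithinAt t
      ((hσ t ht).mdifferentiableWithinAt (by simp)).hasMFDerivWithinAt
    have h2 := (h1.hasFDerivWithinAt.add_const (φ t - F (σ.path t))).congr_of_eventuallyEq
      (e.filter_mono nhdsWithin_le_nhds) e.self_of_nhds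
    rw [h2.hasDerivWithinAt.derivWithin (uniqueDiffOn_Icc_zero_one t ht)]
    rfl
  have h := intervalIntegral.integral_derivWithin_Icc_of_contDiffOn_Icc hsmooth zero_le_one
  have h0 : P 0 = stdSimplex.vertex 0 := by
    refine Subtype.ext ?_
    simp only [P]
    rw [stdSimplexHomeomorphUnitInterval_symm_apply]
    ext i; fin_cases i <;> simp
  have h1 : P 1 = stdSimplex.vertex 1 := by
    refine Subtype.ext ?_
    simp only [P]
    rw [stdSimplexHomeomorphUnitInterval_symm_apply]
    ext i; fin_cases i <;> simp
  simp only [φ, h0, h1] at h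
  rw [cocycle_segment_self, comp_segmentSimplex_vertex, sub_zero] at h
  rw [← h]
  refine intervalIntegral.integral_congr fun t ht => ?_
  rw [Set.uIcc_of_le zero_le_one] at ht
  exact hderiv t ht

/-- A cocycle is determined by its values on smooth simplices, so the one required by `Represents`
can only be `c`. -/
lemma IsPeriod.represents_iff {η : Z1 M} {c : Cocycle1 M ℂ} (hc : IsPeriod η.1 c) (κ : H1 M ℂ) :
    Represents η κ ↔ (QuotientAddGroup.mk c : H1 M ℂ) = κ := by
  constructor
  · rintro ⟨e, rfl, he⟩
    have : c - e = 0 := cocycle_eq_zero_of_smooth _ fun σ hσ => by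
      change c.1 σ - e.1 σ = 0
      rw [he σ hσ, hc.eq_integral hσ, sub_self]
    rw [sub_eq_zero.1 this]
  · intro h
    exact ⟨c, h, fun σ hσ => hc.eq_integral hσ⟩

lemma isPeriod_d0 (f : A0 M) : IsPeriod (d0 f) (diff f) := fun x =>
  ⟨Set.univ, isOpen_univ, Set.mem_univ x, f, isPrimitiveOn_d0 f, fun _ _ => rfl⟩

/-- A form whose periods are the coboundary of a function is the differential of the function. -/
lemma IsPeriod.exists_d0_eq {η : A1 M} {b : M → ℂ} (h : IsPeriod η (diff b)) :
    ∃ f : A0 M, d0 f = η := by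
  -- No regularity of `b` is assumed; it is inherited from the local primitives, from which `b`
  -- differs by local constants.
  have hb : IsPrimitiveOn η.field b Set.univ := fun x _ => by
    obtain ⟨U, hU, hxU, F, hF, hc⟩ := h x
    have e := eventually_sub_eq_sub hU (F := b) (G := F) hc hxU
    exact hasMFDerivAt_of_eventually_sub_eq (hF x hxU) e
  refine ⟨⟨b, fun x => hb.contMDiffAt univ_mem⟩, A1.ext fun x v => ?_⟩
  exact DFunLike.congr_fun (hb x (Set.mem_univ x)).mfderiv v

/-- Every cocycle is cohomologous to the periods of a closed form. -/
lemma exists_isPeriod_cohomologous [T2Space M] [SigmaCompactSpace M] (c : Cocycle1 M ℂ) :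
    ∃ (η : Z1 M) (b : M → ℂ), IsPeriod η.1 (c - diff b) := by
  choose U hU hx F hF _ using exists_local_primitive_of_cocycle c
  obtain ⟨ρ, hρ⟩ := SmoothPartitionOfUnity.exists_isSubordinate (𝓡 2) (isClosed_univ (X := M)) U hU
    fun x _ => Set.mem_iUnion.2 ⟨x, hx x⟩
  -- The local potentials `F x` need not be continuous, but their differences are locally constant.
  -- Averaging them gives a global `u` such that `F x - u` is smooth.
  let u : M → ℂ := fun y => ∑ᶠ x, ρ x y • F x y
  have hFF : ∀ x x' z, z ∈ U x → z ∈ U x' → ∀ᶠ y in 𝓝 z, F x y - F x z = F x' y - F x' z :=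
    fun x x' z hz hz' => eventually_sub_eq_sub ((hU x).inter (hU x')) (fun σ hσ => by
      rw [← hF x σ (hσ.trans Set.inter_subset_left), ← hF x' σ (hσ.trans Set.inter_subset_right)])
      ⟨hz, hz'⟩
  have hu : ∀ x, ∀ z ∈ U x, ContMDiffAt (𝓡 2) 𝓘(ℝ, ℂ) ∞ (fun y => F x y - u y) z := by
    intro x z hz
    -- As the weights sum to 1, `F x - u` is the weighted sum of the differences `F x - F x'`.
    have h : ContMDiffAt (𝓡 2) 𝓘(ℝ, ℂ) ∞ (fun y => ∑ᶠ x', ρ x' y • (F x y - F x' y)) z := by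
      refine ρ.contMDiffAt_finsum fun x' hx' => ?_
      have hz' : z ∈ U x' := hρ x' hx'
      refine (contMDiffAt_const (c := F x z - F x' z)).congr_of_eventuallyEq ?_
      filter_upwards [hFF x x' z hz hz'] with y hy
      linear_combination hy
    refine h.congr_of_eventuallyEq (Eventually.of_forall fun y => ?_)
    have hfin : (Function.support fun x' => ρ x' y).Finite := ρ.locallyFinite.point_finite y
    simp only [u, smul_sub]
    rw [finsum_sub_distrib, ← finsum_smul, ρ.sum_eq_one (Set.mem_univ y), one_smul]
    · exact hfin.subset fun x' h => by
        contrapose! h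
        simp_all
    · exact hfin.subset fun x' h => by
        contrapose! h
        simp_all
  -- At each point its own potential is used; on overlaps the choice does not matter, as the
  -- potentials differ by local constants.
  let ζ : CovectorField M := fun x => mfderiv (𝓡 2) 𝓘(ℝ, ℂ) (fun y => F x y - u y) x
  have hζ : ∀ x, IsPrimitiveOn ζ (fun y => F x y - u y) (U x) := fun x z hz => by
    have h1 := ((hu z z (hx z)).mdifferentiableAt (by simp)).hasMFDerivAt
    refine hasMFDerivAt_of_eventually_sub_eq h1 ?_
    filter_upwards [hFF x z z hz (hx z)] with y hy
    linear_combination hy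
  obtain ⟨η, hη⟩ := exists_closed_of_local (η := ζ) fun x =>
    ⟨U x, (hU x).mem_nhds (hx x), _, hζ x, fun z hz => (hu x z hz).contMDiffWithinAt⟩
  refine ⟨η, u, fun x => ⟨U x, hU x, hx x, _, hη ▸ hζ x, fun σ hσ => ?_⟩⟩
  change c.1 σ - (diff u).1 σ = _
  rw [diff_apply, hF x σ hσ]
  ring

end PeriodCocycle

/-! ### The de Rham isomorphism -/

section DeRham

variable {M : Type*} [TopologicalSpace M] [ChartedSpace (EuclideanSpace ℝ (Fin 2)) M]
  [IsManifold (𝓡 2) ∞ M]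

/-- The singular class of the periods of a closed form. -/
def periodClass : Z1 M →+ H1 M ℂ :=
  AddMonoidHom.mk' (fun η => QuotientAddGroup.mk (exists_isPeriod η).choose) fun η θ => by
    have h := ((exists_isPeriod η).choose_spec.add (exists_isPeriod θ).choose_spec).unique
      (exists_isPeriod (η + θ)).choose_spec
    exact congrArg (QuotientAddGroup.mk : Cocycle1 M ℂ → H1 M ℂ) h.symm

lemma IsPeriod.periodClass_eq {η : Z1 M} {c : Cocycle1 M ℂ} (h : IsPeriod η.1 c) :
    periodClass η = QuotientAddGroup.mk c :=
  congrArg (QuotientAddGroup.mk : Cocycle1 M ℂ → H1 M ℂ)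
    ((exists_isPeriod η).choose_spec.unique h)

lemma periodClass_eq_iff (η : Z1 M) (κ : H1 M ℂ) : periodClass η = κ ↔ Represents η κ :=
  ((exists_isPeriod η).choose_spec.represents_iff κ).symm

/-- Both directions hold already for cocycles: by uniqueness, the periods of `df` are the coboundary
of `f`. -/
lemma periodClass_eq_zero_iff (η : Z1 M) : periodClass η = 0 ↔ η.1 ∈ B1 M := by
  obtain ⟨c, hc⟩ := exists_isPeriod η
  rw [hc.periodClass_eq, mk_eq_zero_iff]
  constructor
  · rintro ⟨b, rfl⟩
    exact hc.exists_d0_eq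
  · rintro ⟨f, hf⟩
    exact ⟨f, hc.unique (hf ▸ isPeriod_d0 f)⟩

lemma periodClass_surjective [T2Space M] [SigmaCompactSpace M] :
    Function.Surjective (periodClass (M := M)) := by
  intro κ
  obtain ⟨c, rfl⟩ := QuotientAddGroup.mk_surjective κ
  obtain ⟨η, b, h⟩ := exists_isPeriod_cohomologous c
  refine ⟨η, h.periodClass_eq.trans ?_⟩
  have hb : (QuotientAddGroup.mk (diff b) : H1 M ℂ) = 0 := (mk_eq_zero_iff _).2 ⟨b, rfl⟩
  rw [QuotientAddGroup.mk_sub, hb, sub_zero]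

variable (M) in
/-- The homomorphism from de Rham to singular cohomology given by periods. -/
def deRhamHom : H1dR M →+ H1 M ℂ :=
  QuotientAddGroup.lift ((B1 M).comap (Z1 M).subtype).toAddSubgroup periodClass
    fun η hη => (periodClass_eq_zero_iff η).2 hη

lemma deRhamHom_mk (η : Z1 M) : deRhamHom M (Submodule.Quotient.mk η) = periodClass η := rfl

variable (M) in
/-- The de Rham isomorphism in degree one. -/
def deRhamEquiv [T2Space M] [SigmaCompactSpace M] : H1dR M ≃+ H1 M ℂ :=
  AddEquiv.ofBijective (deRhamHom M) ⟨by
    rw [injective_iff_map_eq_zero]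
    intro q hq
    obtain ⟨η, rfl⟩ := Submodule.Quotient.mk_surjective _ q
    rw [deRhamHom_mk, periodClass_eq_zero_iff] at hq
    exact (Submodule.Quotient.mk_eq_zero _).2 hq, fun κ => by
    obtain ⟨η, rfl⟩ := periodClass_surjective κ
    exact ⟨Submodule.Quotient.mk η, rfl⟩⟩

lemma deRhamEquiv_mk_eq_iff [T2Space M] [SigmaCompactSpace M] (η : Z1 M) (κ : H1 M ℂ) :
    deRhamEquiv M (Submodule.Quotient.mk η) = κ ↔ Represents η κ :=
  periodClass_eq_iff η κ

end DeRham

/-! ### Integer and complex coefficients -/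

section Coefficients

variable {X : Type*} [TopologicalSpace X]

/-- A class with integer coefficients that vanishes over the complex numbers vanishes. -/
lemma coeffMap_intCast_injective : Function.Injective (coeffMap X (Int.castAddHom ℂ)) := by
  rw [injective_iff_map_eq_zero]
  intro κ h
  obtain ⟨n, rfl⟩ := QuotientAddGroup.mk_surjective κ
  obtain ⟨b, hb⟩ := (mk_eq_zero_iff (cocycleMap X (Int.castAddHom ℂ) n)).1 h
  -- The real part of `b` changes by integers along simplices, and the floor commutes with integer
  -- translations.
  refine (mk_eq_zero_iff n).2 ⟨fun x => ⌊(b x).re⌋, Subtype.ext (funext fun σ => ?_)⟩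
  have h1 : ((n.1 σ : ℤ) : ℂ) = b (σ.vertex 1) - b (σ.vertex 0) :=
    congrFun (congrArg Subtype.val hb) σ
  have h2 : (b (σ.vertex 1)).re = (b (σ.vertex 0)).re + (n.1 σ : ℤ) := by
    have := congrArg Complex.re h1
    simp only [Complex.intCast_re, Complex.sub_re] at this
    linarith
  rw [diff_apply, h2, Int.floor_add_intCast]
  ring

/-- A complex cocycle with integer values on small simplices is an integer cocycle. -/
lemma exists_int_cocycle (e : Cocycle1 X ℂ)
    (h : ∀ x, ∃ U ∈ nhds x, ∀ σ : Simplex X 1, Set.range σ ⊆ U → ∃ n : ℤ, e.1 σ = n) :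
    ∃ n : Cocycle1 X ℤ, cocycleMap X (Int.castAddHom ℂ) n = e := by
  -- Reduced modulo the integers, the cocycle vanishes on small simplices, hence everywhere.
  let q : ℂ →+ ℂ ⧸ (Int.castAddHom ℂ).range := QuotientAddGroup.mk' _
  have h0 : cocycleMap X q e = 0 := cocycle_eq_zero_of_small _ fun x => by
    obtain ⟨U, hU, hn⟩ := h x
    refine ⟨U, hU, fun σ hσ => ?_⟩
    obtain ⟨n, hn⟩ := hn σ hσ
    exact (QuotientAddGroup.eq_zero_iff _).2 ⟨n, hn.symm⟩
  have hint : ∀ σ, ∃ n : ℤ, (n : ℂ) = e.1 σ := fun σ =>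
    (QuotientAddGroup.eq_zero_iff (N := (Int.castAddHom ℂ).range) (e.1 σ)).1
      (congrFun (congrArg Subtype.val h0) σ)
  choose n hn using hint
  refine ⟨Cocycle1.mk n fun σ => ?_, Subtype.ext (funext hn)⟩
  have := cocycle_faces e σ
  rw [← hn, ← hn, ← hn] at this
  exact_mod_cast this

end Coefficients

/-! ### Gauge transformations and integral classes -/

section GaugeClasses

open Filter Topology

variable {M : Type*} [TopologicalSpace M] [ChartedSpace (EuclideanSpace ℝ (Fin 2)) M]

lemma hasMFDerivAt_cexp {F : M → ℂ} {y : M} {L : TangentSpace (𝓡 2) y →L[ℝ] ℂ} (k a : ℂ)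
    (h : HasMFDerivAt (𝓡 2) 𝓘(ℝ, ℂ) F y L) :
    HasMFDerivAt (𝓡 2) 𝓘(ℝ, ℂ) (fun z => k * Complex.exp (a * F z)) y
      ((k * (Complex.exp (a * F y) * a)) • L) := by
  have h1 : HasDerivAt (fun w : ℂ => k * Complex.exp (a * w)) (k * (Complex.exp (a * F y) * a))
      (F y) := by
    simpa using (((hasDerivAt_id (F y)).const_mul a).cexp).const_mul k
  have h2 := (h1.hasFDerivAt.restrictScalars ℝ).hasMFDerivAt.comp y h
  refine h2.congr_mfderiv ?_
  ext v
  change L v * _ = _ * L v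
  ring

variable [IsManifold (𝓡 2) ∞ M]

lemma inv_smul_d0_eq_iff (g : Gauge M) (θ : A1 M) :
    Gauge.toA0 g⁻¹ • d0 g.toA0 = θ ↔ d0 g.toA0 = g.toA0 • θ := by
  constructor
  · rintro rfl
    rw [← mul_smul_form, mul_comm, Gauge.toA0_inv_mul, one_smul_form]
  · intro h
    rw [h, ← mul_smul_form, Gauge.toA0_inv_mul, one_smul_form]

/-- The logarithmic derivative of a gauge transformation represents an integral class. -/
lemma exists_int_class_of_gauge {θ : Z1 M} {g : Gauge M}
    (h : d0 g.toA0 = g.toA0 • (2 * Real.pi * Complex.I : ℂ) • θ.1) :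
    ∃ κ : H1 M ℤ, periodClass θ = coeffMap M (Int.castAddHom ℂ) κ := by
  set a : ℂ := 2 * Real.pi * Complex.I with ha
  have ha0 : a ≠ 0 := Complex.two_pi_I_ne_zero
  obtain ⟨c, hc⟩ := exists_isPeriod θ
  -- The principal branch may jump; only `exp (a * L) = g` is used.
  let L : M → ℂ := fun x => Complex.log (g x) / a
  have hL : ∀ x, Complex.exp (a * L x) = g x := fun x => by
    rw [mul_div_cancel₀ _ ha0, Complex.exp_log (g x).ne_zero]
  obtain ⟨n, hn⟩ := exists_int_cocycle (c - diff L) fun x => by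
    obtain ⟨U, hU, hxU, F, hF, hcF⟩ := hc x
    -- The function `g exp(-a F)` has zero differential, so `a (L - F)` is locally constant up to
    -- multiples of `2πi`.
    have hG : IsPrimitiveOn (0 : CovectorField M)
        (g.toA0 * fun y => 1 * Complex.exp (-a * F y)) U := fun y hy => by
      have h1 := isPrimitiveOn_d0 g.toA0 y (Set.mem_univ y)
      rw [h] at h1
      refine (h1.mul (hasMFDerivAt_cexp 1 (-a) (hF y hy))).congr_mfderiv ?_
      ext v
      change g.toA0 y * ((1 * (Complex.exp (-a * F y) * -a)) * θ.1.field y v)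
        + 1 * Complex.exp (-a * F y) * (g.toA0 y * (a * θ.1.field y v)) = 0
      ring
    have h0 : IsPrimitiveOn (0 : CovectorField M) (fun _ => 0) U := fun y _ =>
      hasMFDerivAt_const 0 y
    refine ⟨_, inter_mem (hU.mem_nhds hxU)
      (hG.eventually_sub_eq h0 (hU.mem_nhds hxU) (hU.mem_nhds hxU)), fun σ hσ => ?_⟩
    have hv : ∀ i, Complex.exp (a * L (σ.vertex i)) * Complex.exp (-a * F (σ.vertex i))
        = g x * Complex.exp (-a * F x) := fun i => by
      have := (hσ ⟨stdSimplex.vertex i, rfl⟩).2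
      rw [hL, ← one_mul (Complex.exp (-a * F x)), ← one_mul (Complex.exp (-a * F _))]
      exact sub_eq_zero.1 (this.trans (sub_zero 0))
    have h3 := (hv 0).trans (hv 1).symm
    rw [← Complex.exp_add, ← Complex.exp_add, Complex.exp_eq_exp_iff_exists_int] at h3
    obtain ⟨m, hm⟩ := h3
    refine ⟨m, ?_⟩
    change c.1 σ - (diff L).1 σ = m
    rw [hcF σ fun y hy => (hσ hy).1, diff_apply]
    apply mul_left_cancel₀ ha0
    rw [← ha] at hm
    linear_combination hm
  refine ⟨QuotientAddGroup.mk n, ?_⟩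
  change _ = (QuotientAddGroup.mk (cocycleMap M (Int.castAddHom ℂ) n) : H1 M ℂ)
  have hb : (QuotientAddGroup.mk (diff L) : H1 M ℂ) = 0 := (mk_eq_zero_iff _).2 ⟨L, rfl⟩
  rw [hn, hc.periodClass_eq, QuotientAddGroup.mk_sub, hb, sub_zero]

/-- A closed form that represents an integral class is a logarithmic derivative. -/
lemma exists_gauge_of_int_class {θ : Z1 M} {κ : H1 M ℤ}
    (h : periodClass θ = coeffMap M (Int.castAddHom ℂ) κ) :
    ∃ g : Gauge M, d0 g.toA0 = g.toA0 • (2 * Real.pi * Complex.I : ℂ) • θ.1 := by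
  set a : ℂ := 2 * Real.pi * Complex.I with ha
  obtain ⟨c, hc⟩ := exists_isPeriod θ
  obtain ⟨n, rfl⟩ := QuotientAddGroup.mk_surjective κ
  obtain ⟨b, hb⟩ : ∃ b, c - cocycleMap M (Int.castAddHom ℂ) n = diff b := by
    rw [← mk_eq_zero_iff, QuotientAddGroup.mk_sub, ← hc.periodClass_eq, h]
    exact sub_self _
  have hloc : ∀ x, ∃ U, IsOpen U ∧ x ∈ U ∧ ∃ F, IsPrimitiveOn θ.1.field F U ∧
      ∀ᶠ y in 𝓝 x, Complex.exp (a * b y)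
        = Complex.exp (a * b x) * Complex.exp (-a * F x) * Complex.exp (a * F y) := by
    intro x
    obtain ⟨U, hU, hxU, F, hF, hcF⟩ := hc x
    refine ⟨U, hU, hxU, F, hF, ?_⟩
    -- On simplices in `U` the function `b - F` changes by an integer, so `exp(a (b - F))` has zero
    -- coboundary there and is locally constant.
    filter_upwards [eventually_sub_eq_sub hU
      (F := fun y => Complex.exp (a * b y + -a * F y)) (G := fun _ => 0) (fun σ hσ => by
        have h1 : c.1 σ - ((n.1 σ : ℤ) : ℂ) = b (σ.vertex 1) - b (σ.vertex 0) :=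
          congrFun (congrArg Subtype.val hb) σ
        rw [hcF σ hσ] at h1
        rw [sub_self, sub_eq_zero, Complex.exp_eq_exp_iff_exists_int]
        refine ⟨-n.1 σ, ?_⟩
        push_cast
        rw [← ha]
        linear_combination -a * h1) hxU] with y hy
    have h2 : Complex.exp (a * b y + -a * F y) = Complex.exp (a * b x + -a * F x) := by
      rw [← sub_eq_zero]; simpa using hy
    rw [← Complex.exp_add (a * b x), ← h2, ← Complex.exp_add]
    congr 1
    ring
  have hderiv : ∀ x, HasMFDerivAt (𝓡 2) 𝓘(ℝ, ℂ) (fun y => Complex.exp (a * b y)) x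
      ((Complex.exp (a * b x) * a) • θ.1.field x) := fun x => by
    obtain ⟨U, hU, hxU, F, hF, e⟩ := hloc x
    have h1 := hasMFDerivAt_cexp (Complex.exp (a * b x) * Complex.exp (-a * F x)) a (hF x hxU)
    refine (h1.congr_of_eventuallyEq e).congr_mfderiv ?_
    rw [← mul_assoc, ← e.self_of_nhds]
  have hsmooth : ContMDiff (𝓡 2) 𝓘(ℝ, ℂ) ∞ fun y => Complex.exp (a * b y) := fun x => by
    obtain ⟨U, hU, hxU, F, hF, e⟩ := hloc x
    have hFs := hF.contMDiffAt (hU.mem_nhds hxU)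
    have h1 : ContDiff ℝ ∞ fun w : ℂ =>
        Complex.exp (a * b x) * Complex.exp (-a * F x) * Complex.exp (a * w) := by fun_prop
    exact (h1.contMDiff.contMDiffAt.comp x hFs).congr_of_eventuallyEq e
  let g : Gauge M := ⟨fun x => Units.mk0 (Complex.exp (a * b x)) (Complex.exp_ne_zero _),
    ContMDiff.of_comp_isOpenEmbedding Units.isOpenEmbedding_val hsmooth⟩
  refine ⟨g, A1.ext fun x v => ?_⟩
  refine (DFunLike.congr_fun (hderiv x).mfderiv v).trans ?_
  change Complex.exp (a * b x) * a * θ.1.field x v = Complex.exp (a * b x) * (a * θ.1.field x v)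
  ring

end GaugeClasses

/-! ### Flat connections -/

section FlatConnections

variable {M : Type*} [TopologicalSpace M] [ChartedSpace (EuclideanSpace ℝ (Fin 2)) M]
  [IsManifold (𝓡 2) ∞ M]

lemma inChart_self (η : CovectorField M) (x : M) (v : TangentSpace (𝓡 2) x) :
    η.inChart x (extChartAt (𝓡 2) x x) (chartDeriv x v) = η x v := by
  have h3 := DFunLike.congr_fun (mfderiv_chart_symm_comp (mem_extChartAt_source (I := 𝓡 2) x)) v
  exact (η.congr_point (extChartAt_to_inv x) _).trans (congrArg (η x) h3)

/-- The Leibniz rule for the exterior derivative of a `1`-form. -/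
lemma d1_smul_form (s : A0 M) (η : A1 M) (x : M) :
    d1 (s • η) x = s x • d1 η x + wedge ((d0 s).field x) (η.field x) := by
  ext v
  set y := extChartAt (𝓡 2) x x
  set w := η.field.inChart x
  have hw := differentiableAt_inChart η x
  have hs := hasFDerivAt_comp_chart_symm x (mem_extChartAt_target x)
    (isPrimitiveOn_d0 s _ (Set.mem_univ _))
  have e : (s • η).field.inChart x = (s ∘ (extChartAt (𝓡 2) x).symm) • η.field.inChart x :=
    inChart_mul _ _ _
  have hd := hs.smul hw.hasFDerivAt
  rw [ContinuousAlternatingMap.add_apply, ContinuousAlternatingMap.smul_apply, d1_apply, d1_apply,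
    planeDeriv_apply (differentiableAt_inChart _ x), planeDeriv_apply hw, e, hd.fderiv]
  have h0 : (s ∘ (extChartAt (𝓡 2) x).symm) y = s x := congrArg s (extChartAt_to_inv x)
  change ((s ∘ (extChartAt (𝓡 2) x).symm) y * fderiv ℝ w y (chartDeriv x (v 0)) (chartDeriv x (v 1))
      + (d0 s).field.inChart x y (chartDeriv x (v 0)) * w y (chartDeriv x (v 1)))
    - ((s ∘ (extChartAt (𝓡 2) x).symm) y * fderiv ℝ w y (chartDeriv x (v 1)) (chartDeriv x (v 0))
      + (d0 s).field.inChart x y (chartDeriv x (v 1)) * w y (chartDeriv x (v 0)))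
    = s x * (fderiv ℝ w y (chartDeriv x (v 0)) (chartDeriv x (v 1))
        - fderiv ℝ w y (chartDeriv x (v 1)) (chartDeriv x (v 0)))
      + ((d0 s).field x (v 0) * η.field x (v 1) - (d0 s).field x (v 1) * η.field x (v 0))
  rw [h0, inChart_self, inChart_self, inChart_self, inChart_self]
  ring

/-- The Leibniz rule is applied to `s = s * 1`. -/
lemma Connection.toHom_eq (D : Connection M) (s : A0 M) : D.toHom s = s • D.toHom 1 + d0 s := by
  have := D.leibniz s 1
  rwa [mul_one, one_smul_form] at this

lemma Connection.ext_form {D D' : Connection M} (h : D.toHom 1 = D'.toHom 1) : D = D' :=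
  Connection.ext (AddMonoidHom.ext fun s => by rw [D.toHom_eq, D'.toHom_eq, h])

/-- The connection with a given connection form. -/
def Connection.ofForm (η : A1 M) : Connection M where
  toHom := AddMonoidHom.mk' (fun s => s • η + d0 s) fun s t => by
    have : (s + t) • η = s • η + t • η := A1.ext fun _ _ => add_mul _ _ _
    rw [this, map_add, add_add_add_comm]
  leibniz f s := by
    change (f * s) • η + d0 (f * s) = f • (s • η + d0 s) + s • d0 f
    rw [d0_mul, mul_smul_form, smul_add_form, add_assoc]

lemma Connection.ofForm_toHom_one (η : A1 M) : (Connection.ofForm η).toHom 1 = η := by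
  have h1 : d0 (1 : A0 M) = 0 := d0_const 1
  change (1 : A0 M) • η + d0 1 = η
  rw [h1, one_smul_form, add_zero]

/-- In `d(s η + ds) - (s η + ds) ∧ η` the two terms `ds ∧ η` cancel, while `η ∧ η` and `d(ds)`
vanish. -/
lemma Connection.extend_toHom (D : Connection M) (s : A0 M) (x : M) :
    D.extend (D.toHom s) x = s x • d1 (D.toHom 1) x := by
  unfold Connection.extend
  rw [D.toHom_eq s, d1_add, d1_d0, d1_smul_form]
  ext v
  change s x * d1 (D.toHom 1) x v + ((d0 s).field x (v 0) * (D.toHom 1).field x (v 1)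
      - (d0 s).field x (v 1) * (D.toHom 1).field x (v 0)) + 0
    - ((s x * (D.toHom 1).field x (v 0) + (d0 s).field x (v 0)) * (D.toHom 1).field x (v 1)
      - (s x * (D.toHom 1).field x (v 1) + (d0 s).field x (v 1)) * (D.toHom 1).field x (v 0))
    = s x * d1 (D.toHom 1) x v
  ring

/-- A connection is flat if and only if its connection form is closed. -/
lemma Connection.isFlat_iff (D : Connection M) : D.IsFlat ↔ D.toHom 1 ∈ Z1 M := by
  constructor
  · intro h x
    have h1 := h 1 x
    rw [D.extend_toHom] at h1
    ext v
    have h2 := congrArg (fun T => T v) h1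
    exact (one_mul _).symm.trans h2
  · intro h s x
    rw [D.extend_toHom, h x]
    ext v
    exact mul_zero _

/-- The closed connection form of a flat connection. -/
def connectionForm (D : FlatConnection M) : Z1 M := ⟨D.1.toHom 1, D.1.isFlat_iff.1 D.2⟩

lemma gauge_smul_toHom_one (g : Gauge M) (D : Connection M) :
    (g • D).toHom 1 = D.toHom 1 + Gauge.toA0 g⁻¹ • d0 g.toA0 := by
  change Gauge.toA0 g⁻¹ • D.toHom (g.toA0 * 1) = _
  rw [mul_one, D.toHom_eq, smul_add_form, ← mul_smul_form, Gauge.toA0_inv_mul, one_smul_form]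

/-- Flat connections are gauge equivalent if and only if their connection forms differ, up to the
factor `2πi`, by a form that represents an integral class. -/
lemma gauge_equivalent_iff (D D' : FlatConnection M) :
    (MulAction.orbitRel (Gauge M) (Connection M)) D.1 D'.1 ↔ ∃ κ : H1 M ℤ,
      periodClass ((2 * Real.pi * Complex.I : ℂ)⁻¹ • (connectionForm D - connectionForm D'))
        = coeffMap M (Int.castAddHom ℂ) κ := by
  have ha0 : (2 * Real.pi * Complex.I : ℂ) ≠ 0 := Complex.two_pi_I_ne_zero
  have hθ : (2 * Real.pi * Complex.I : ℂ) •
      ((2 * Real.pi * Complex.I : ℂ)⁻¹ • (connectionForm D - connectionForm D')).1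
        = D.1.toHom 1 - D'.1.toHom 1 := smul_inv_smul₀ ha0 _
  rw [MulAction.orbitRel_apply, MulAction.mem_orbit_iff]
  constructor
  · rintro ⟨g, hg⟩
    refine exists_int_class_of_gauge (g := g) ?_
    rw [hθ, ← inv_smul_d0_eq_iff, ← hg, gauge_smul_toHom_one, add_sub_cancel_left]
  · rintro ⟨κ, hκ⟩
    obtain ⟨g, hg⟩ := exists_gauge_of_int_class hκ
    refine ⟨g, Connection.ext_form ?_⟩
    rw [hθ, ← inv_smul_d0_eq_iff] at hg
    rw [gauge_smul_toHom_one, hg, add_sub_cancel]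

end FlatConnections

end FlatLine
end

/-! ### The moduli space as a cokernel -/

theorem mainTheorem6 {S : Type*} [TopologicalSpace S] [CompactSpace S] [T2Space S]
    [ChartedSpace (EuclideanSpace ℝ (Fin 2)) S] [IsManifold (𝓡 2) ∞ S] :
    -- the de Rham isomorphism, given by integration
    ∃ dR : FlatLine.H1dR S ≃+ FlatLine.H1 S ℂ,
      (∀ (η : FlatLine.Z1 S) (κ : FlatLine.H1 S ℂ),
        dR (Submodule.Quotient.mk η) = κ ↔ FlatLine.Represents η κ) ∧
      -- the map induced by the inclusion of the integers in the complex numbers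
      ∃ i : FlatLine.H1 S ℤ →+ FlatLine.H1dR S,
        i = dR.symm.toAddMonoidHom.comp (FlatLine.coeffMap S (Int.castAddHom ℂ)) ∧
        Function.Injective i ∧
        -- the identification of the moduli space with the cokernel
        ∃ Φ : FlatLine.Moduli S ≃ FlatLine.H1dR S ⧸ i.range,
          ∀ D : FlatLine.FlatConnection S, ∃ η : FlatLine.Z1 S,
            (η : FlatLine.A1 S) = D.1.toHom 1 ∧
            Φ (Quotient.mk _ D) = QuotientAddGroup.mk
              ((2 * Real.pi * Complex.I)⁻¹ • (Submodule.Quotient.mk η : FlatLine.H1dR S)) := by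
  refine ⟨FlatLine.deRhamEquiv S, FlatLine.deRhamEquiv_mk_eq_iff, _, rfl,
    (FlatLine.deRhamEquiv S).symm.injective.comp FlatLine.coeffMap_intCast_injective, ?_⟩
  set i := (FlatLine.deRhamEquiv S).symm.toAddMonoidHom.comp
    (FlatLine.coeffMap S (Int.castAddHom ℂ))
  have ha0 : (2 * Real.pi * Complex.I : ℂ) ≠ 0 := Complex.two_pi_I_ne_zero
  let Ψ : FlatLine.FlatConnection S → FlatLine.H1dR S ⧸ i.range := fun D =>
    QuotientAddGroup.mk ((2 * Real.pi * Complex.I : ℂ)⁻¹ •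
      (Submodule.Quotient.mk (FlatLine.connectionForm D) : FlatLine.H1dR S))
  have hΨ : ∀ D D', Ψ D = Ψ D' ↔
      (MulAction.orbitRel (FlatLine.Gauge S) (FlatLine.Connection S)) D.1 D'.1 := by
    intro D D'
    rw [FlatLine.gauge_equivalent_iff, ← sub_eq_zero]
    simp only [Ψ]
    rw [← QuotientAddGroup.mk_sub, QuotientAddGroup.eq_zero_iff, ← smul_sub,
      ← Submodule.Quotient.mk_sub, ← Submodule.Quotient.mk_smul]
    refine exists_congr fun κ => ?_
    change (FlatLine.deRhamEquiv S).symm _ = _ ↔ _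
    rw [AddEquiv.symm_apply_eq, eq_comm]
    rfl
  have hsurj : Function.Surjective Ψ := fun q => by
    obtain ⟨q, rfl⟩ := QuotientAddGroup.mk_surjective q
    obtain ⟨η, rfl⟩ := Submodule.Quotient.mk_surjective _ q
    -- The factor `2πi` in the connection form cancels the normalization in `Ψ`.
    let D : FlatLine.Connection S :=
      FlatLine.Connection.ofForm ((2 * Real.pi * Complex.I : ℂ) • η.1)
    have hD : D.toHom 1 = (2 * Real.pi * Complex.I : ℂ) • η.1 :=
      FlatLine.Connection.ofForm_toHom_one _
    have hflat : D.IsFlat := by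
      rw [FlatLine.Connection.isFlat_iff, hD]
      exact (FlatLine.Z1 S).smul_mem _ η.2
    refine ⟨⟨D, hflat⟩, ?_⟩
    have e : FlatLine.connectionForm ⟨D, hflat⟩ = (2 * Real.pi * Complex.I : ℂ) • η :=
      Subtype.ext hD
    simp only [Ψ]
    rw [e, Submodule.Quotient.mk_smul, inv_smul_smul₀ ha0]
  refine ⟨Equiv.ofBijective (Quotient.lift Ψ fun D D' h => (hΨ D D').2 h)
    ⟨?_, fun q => ?_⟩, fun D => ⟨FlatLine.connectionForm D, rfl, rfl⟩⟩
  · rintro ⟨D⟩ ⟨D'⟩ h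
    exact Quotient.sound ((hΨ D D').1 h)
  · obtain ⟨D, rfl⟩ := hsurj q
    exact ⟨Quotient.mk _ D, rfl⟩
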